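/- Let $\mathbb{T}=\mathbb{R}/\mathbb{Z}$. For a compact abelian group $G$ write $\int_G$ for integration against the Haar measure of total mass $1$. A linear form in $t$ variables is $L(x)=c_1x_1+\cdots+c_tx_t$ with non-zero integer coefficients $c_i$; for a bounded measurable $f$ on $G$ put $$S_L(f)=\int_{\ker L} f(x_1)\cdots f(x_t)\,d\mu_L(x),$$ where $\mu_L$ is the Haar probability measure on the closed subgroup $\ker L=\{x\in G^t: L(x)=0\}$. If the coefficients of $L$ are coprime (that is, $\gcd(c_1,\ldots,c_t)=1$), the multiplier-height $h(L)$ is the minimum of $|n_1|+\cdots+|n_t|$ over integers $n_i$ with $n_1c_1+\cdots+n_tc_t=1$. For compact abelian groups $G,H$ and an integer $k\ge 0$, a form $L$ in at least three variables with coprime coefficients is $(G,H,k)$-admissible if $c_i\cdot G=G$ and $c_i\cdot H=H$ for every $i$, and $k\ge\max\{h(L),|c_1|,\ldots,|c_t|\}$. **Corollary.** Let $\epsilon>0$, let $h$ be a positive integer and let $k\ge 0$ be an integer. There is a constant $C=C(\epsilon,h,k)$ with the following property. Let each of $G$ and $H$ be either $\mathbb{T}$ or $\mathbb{Z}_p$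 for a prime $p\ge C$ (if both are finite, the two primes may be equal or different). Then for every measurable function $f:G\to[0,1]$ with $\int_G f=\alpha$ there is a continuous function $g:H\to[0,1]$ with $\int_H g=\alpha$ such that $$|S_L(f)-S_L(g)|\le t\,\epsilon\,\alpha^{t-2}$$ for every $t\ge 3$ and every $(G,H,k)$-admissible linear form $L$ in $t$ variables with multiplier-height at most $h$. -/

import Mathlib

open MeasureTheory

/-- The Haar measure of total mass `1` on a compact abelian group. -/
noncomputable def normHaar (G : Type*) [AddCommGroup G] [TopologicalSpace G]
    [IsTopologicalAddGroup G] [CompactSpace G] [MeasurableSpace G] [BorelSpace G] : Measure G :=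
  Measure.addHaarMeasure (⊤ : TopologicalSpace.PositiveCompacts G)

theorem normHaar_univ (G : Type*) [AddCommGroup G] [TopologicalSpace G]
    [IsTopologicalAddGroup G] [CompactSpace G] [MeasurableSpace G] [BorelSpace G] :
    normHaar G Set.univ = 1 :=
  Measure.addHaarMeasure_self (K₀ := (⊤ : TopologicalSpace.PositiveCompacts G))

/-- A linear form `c₁ x₁ + ⋯ + c_t x_t` in `t` variables with non-zero integer coefficients. -/
structure IntLinearForm (t : ℕ) where
  /-- the coefficients -/
  coeff : Fin t → ℤ
  coeff_ne_zero : ∀ i, coeff i ≠ 0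

namespace IntLinearForm

variable {t : ℕ}

/-- The homomorphism `Gᵗ → G`, `x ↦ c₁ x₁ + ⋯ + c_t x_t`. -/
def eval (L : IntLinearForm t) (G : Type*) [AddCommGroup G] : (Fin t → G) →+ G where
  toFun x := ∑ i, L.coeff i • x i
  map_zero' := by simp
  map_add' x y := by simp [Finset.sum_add_distrib]

/-- The subgroup `ker L = {x ∈ Gᵗ : L(x) = 0}` of `Gᵗ`. -/
def ker (L : IntLinearForm t) (G : Type*) [AddCommGroup G] : AddSubgroup (Fin t → G) :=
  (L.eval G).ker

theorem isClosed_ker (L : IntLinearForm t) (G : Type*) [AddCommGroup G] [TopologicalSpace G]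
    [IsTopologicalAddGroup G] [T2Space G] : IsClosed (L.ker G : Set (Fin t → G)) := by
  have h : Continuous fun x : Fin t → G => ∑ i, L.coeff i • x i := by fun_prop
  exact isClosed_singleton.preimage h

instance compactSpace_ker (L : IntLinearForm t) (G : Type*) [AddCommGroup G] [TopologicalSpace G]
    [IsTopologicalAddGroup G] [CompactSpace G] [T2Space G] : CompactSpace (L.ker G) :=
  isCompact_iff_compactSpace.mp (L.isClosed_ker G).isCompact

/-- The solution operator
`S_L(f₁, …, f_t) = ∫_{ker L} f₁(x₁) ⋯ f_t(x_t) dμ_L(x)`, where `μ_L` is the normalized Haar measure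
on the compact group `ker L`, for real- or complex-valued functions. -/
noncomputable def sol (L : IntLinearForm t) {𝕜 : Type*} [RCLike 𝕜] {G : Type*} [AddCommGroup G]
    [TopologicalSpace G] [IsTopologicalAddGroup G] [CompactSpace G] [T2Space G]
    [SecondCountableTopology G] [MeasurableSpace G] [BorelSpace G] (f : Fin t → G → 𝕜) : 𝕜 :=
  ∫ x : L.ker G, ∏ i, f i (x.1 i) ∂(normHaar (L.ker G))

/-- The coefficients are coprime (as a family, not necessarily pairwise). -/
def HasCoprimeCoeffs (L : IntLinearForm t) : Prop := Finset.univ.gcd L.coeff = 1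

/-- The multiplier-height `h(L)`: the least value of `|n₁| + ⋯ + |n_t|` over integers `nᵢ` with
`n₁ c₁ + ⋯ + n_t c_t = 1`. Such integers exist when the coefficients are coprime. -/
noncomputable def multiplierHeight (L : IntLinearForm t) : ℕ :=
  sInf {m : ℕ | ∃ n : Fin t → ℤ, ∑ i, n i * L.coeff i = 1 ∧ ∑ i, (n i).natAbs = m}

/-- Each coefficient gives a surjective dilation: `cᵢ · G = G`. -/
def IsAdmissible (L : IntLinearForm t) (G : Type*) [AddCommGroup G] : Prop :=
  ∀ i, Function.Surjective fun x : G => L.coeff i • x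

/-- `k ≥ max {h(L), |c₁|, …, |c_t|}`. -/
def IsHeightAdmissible (L : IntLinearForm t) (k : ℕ) : Prop :=
  L.multiplierHeight ≤ k ∧ ∀ i, (L.coeff i).natAbs ≤ k

end IntLinearForm

/-- Every measurable `f : G → [0,1]` has a continuous counterpart `g : H → [0,1]` with the same mean
`α` such that `|S_L(f) - S_L(g)| ≤ t ε α^(t-2)` for all `(G,H,k)`-admissible forms `L`
in `t ≥ 3` variables (with coprime coefficients) of multiplier-height at most `h`. -/
def Transfers (ε : ℝ) (h k : ℕ) (G H : Type*)
    [AddCommGroup G] [TopologicalSpace G] [IsTopologicalAddGroup G] [CompactSpace G] [T2Space G]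
    [SecondCountableTopology G] [MeasurableSpace G] [BorelSpace G]
    [AddCommGroup H] [TopologicalSpace H] [IsTopologicalAddGroup H] [CompactSpace H] [T2Space H]
    [SecondCountableTopology H] [MeasurableSpace H] [BorelSpace H] : Prop :=
  ∀ (f : G → ℝ) (α : ℝ), Measurable f → (∀ x, f x ∈ Set.Icc (0 : ℝ) 1) →
    ∫ x, f x ∂(normHaar G) = α →
    ∃ g : H → ℝ, Continuous g ∧ (∀ x, g x ∈ Set.Icc (0 : ℝ) 1) ∧
      ∫ x, g x ∂(normHaar H) = α ∧
      ∀ (t : ℕ) (L : IntLinearForm t), 3 ≤ t → L.HasCoprimeCoeffs →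
        L.IsAdmissible G → L.IsAdmissible H → L.IsHeightAdmissible k →
        L.multiplierHeight ≤ h →
        |L.sol (fun _ => f) - L.sol (fun _ => g)| ≤ t * ε * α ^ (t - 2)

/-! For a trigonometric polynomial `f`, `S_L(f)` is the sum over frequencies `r` of `∏ f̂(c_i r)`,
so it sees only the coefficients and the linear relations among the frequencies. The proof replaces
`f` by a trigonometric polynomial built from boundedly many frequencies and then renames these
inside the dual of `H`.

Smoothing. By Parseval at most `ε⁻²` frequencies have `|f̂| > ε`. Polynomial growth of sumsets
(`exists_autocorr_ge`) gives a finite set `A` in the dual, of size bounded in terms of `ε`, almost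
invariant under translation by all of them. The Fejér-type kernel `|∑_{a ∈ A} χ_a|² / |A|` is
nonnegative, has mean one, and has Fourier coefficients `autocorr A`. Convolution with it nearly
fixes the large coefficients, and the small ones matter little by Cauchy–Schwarz, so `S_L` moves by
at most `t ε α^(t-2)` (`abs_sol_sub_sol_transfer_le`).

Renaming. In `transfer` the kernel uses the characters `φ a` of `H` in the second variable. It is
still a square, so values stay in `[0,1]`; the mean survives because `φ` is injective on `A`. By a
Bézout multiplier, whether a tuple of differences from `A` has the form `(c_i r)` is a system of
integer relations in `A` with coefficients at most `1 + k h`. If `φ` preserves and reflects these,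
`S_L` does not change at all (`sol_transfer_eq`).

Such `φ` exist from `ZMod p` to `ℤ` and from `ℤ` to `ZMod q` for large moduli. The size of `A` and
the height of the relations depend only on `ε, h, k`, hence so does the threshold. -/

open scoped ComplexConjugate

/-! ### Freiman-type models: moving bounded linear relations between `ZMod p` and `ℤ` -/

/-- Every `n`-tuple in `Γ` has a counterpart in `Γ'` which satisfies exactly the same linear
relations with integer coefficients of size at most `R`. -/
def FreimanTransfers (n R : ℕ) (Γ Γ' : Type*) [AddCommGroup Γ] [AddCommGroup Γ'] : Prop :=
  ∀ v : Fin n → Γ, ∃ w : Fin n → Γ', ∀ c : Fin n → ℤ, (∀ i, |c i| ≤ R) →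
    (∑ i, c i • v i = 0 ↔ ∑ i, c i • w i = 0)

theorem FreimanTransfers.refl (n R : ℕ) (Γ : Type*) [AddCommGroup Γ] : FreimanTransfers n R Γ Γ :=
  fun v => ⟨v, fun _ _ => Iff.rfl⟩

theorem FreimanTransfers.trans {n R : ℕ} {Γ Γ' Γ'' : Type*} [AddCommGroup Γ] [AddCommGroup Γ']
    [AddCommGroup Γ''] (h : FreimanTransfers n R Γ Γ') (h' : FreimanTransfers n R Γ' Γ'') :
    FreimanTransfers n R Γ Γ'' := fun v => by
  obtain ⟨w, hw⟩ := h v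
  obtain ⟨u, hu⟩ := h' w
  exact ⟨u, fun c hc => (hw c hc).trans (hu c hc)⟩

theorem abs_sum_mul_le {n : ℕ} {c w : Fin n → ℤ} {R B : ℤ} (hR : 0 ≤ R) (hc : ∀ i, |c i| ≤ R)
    (hw : ∀ i, |w i| ≤ B) : |∑ i, c i * w i| ≤ n * R * B := by
  calc |∑ i, c i * w i| ≤ ∑ i, |c i * w i| := Finset.abs_sum_le_sum_abs _ _
    _ ≤ ∑ _i : Fin n, R * B := by
        refine Finset.sum_le_sum fun i _ => ?_
        rw [abs_mul]
        exact mul_le_mul (hc i) (hw i) (abs_nonneg _) hR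
    _ = n * R * B := by simp [mul_assoc]

theorem intCast_zmod_eq_zero_iff_of_abs_lt {p : ℕ} {a : ℤ} (h : |a| < p) :
    ((a : ZMod p) = 0) ↔ a = 0 := by
  rw [ZMod.intCast_zmod_eq_zero_iff_dvd]
  exact ⟨fun hd => Int.eq_zero_of_abs_lt_dvd hd h, fun h0 => h0 ▸ dvd_zero _⟩

/-- Simultaneous Dirichlet approximation rectifies a tuple of residues. -/
theorem freimanTransfers_zmod_int (n R p : ℕ) [Fact p.Prime] (hp : (n * R + 1) ^ n < p) :
    FreimanTransfers n R (ZMod p) ℤ := by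
  intro v
  set D := n * R + 1 with hD
  have hp0 : 0 < p := (Fact.out : p.Prime).pos
  -- The dilates `u • v` fall into `D ^ n < p` boxes of side `p / D`, so two of them share a box.
  -- The difference of their representatives is an integer lift of `(a - b) • v` with entries below
  -- `p / D`; as `n * R < D`, its relation sums cannot wrap around modulo `p`.
  let box : ZMod p → Fin n → ℕ := fun u i => (u * v i).val * D / p
  have hmaps : ∀ u ∈ (Finset.univ : Finset (ZMod p)),
      box u ∈ Fintype.piFinset fun _ : Fin n => Finset.range D := by
    intro u _
    rw [Fintype.mem_piFinset]
    intro i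
    rw [Finset.mem_range, Nat.div_lt_iff_lt_mul hp0, mul_comm D]
    exact Nat.mul_lt_mul_of_pos_right (ZMod.val_lt _) (by omega)
  obtain ⟨a, -, b, -, hab, hbox⟩ := Finset.exists_ne_map_eq_of_card_lt_of_maps_to
    (by simpa [Fintype.card_piFinset, ZMod.card] using hp) hmaps
  refine ⟨fun i => ((a * v i).val : ℤ) - (b * v i).val, fun c hc => ?_⟩
  have hw : ∀ i, |((a * v i).val : ℤ) - (b * v i).val| * D < p := by
    intro i
    have h1 : (a * v i).val * D / p = (b * v i).val * D / p := congrFun hbox i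
    have ha := Nat.div_add_mod ((a * v i).val * D) p
    have hb := Nat.div_add_mod ((b * v i).val * D) p
    have ha' := Nat.mod_lt ((a * v i).val * D) hp0
    have hb' := Nat.mod_lt ((b * v i).val * D) hp0
    rw [h1] at ha
    have hD0 : (0 : ℤ) ≤ D := by positivity
    rw [show |((a * v i).val : ℤ) - (b * v i).val| * D =
      |(((a * v i).val : ℤ) - (b * v i).val) * D| by rw [abs_mul, abs_of_nonneg hD0], abs_lt]
    zify at ha hb ha' hb'
    have ha0 : (0 : ℤ) ≤ ((a * v i).val * D : ℤ) % p := Int.emod_nonneg _ (by omega)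
    have hb0 : (0 : ℤ) ≤ ((b * v i).val * D : ℤ) % p := Int.emod_nonneg _ (by omega)
    constructor <;> nlinarith
  have hlt : |∑ i, c i • (((a * v i).val : ℤ) - (b * v i).val)| < p := by
    set s := ∑ i, c i • (((a * v i).val : ℤ) - (b * v i).val) with hs
    have h1 : |s| * D ≤ n * R * p := by
      have : s * D = ∑ i, c i * ((((a * v i).val : ℤ) - (b * v i).val) * D) := by
        rw [hs, Finset.sum_mul]
        exact Finset.sum_congr rfl fun i _ => by rw [smul_eq_mul, mul_assoc]
      have hD0 : (0 : ℤ) ≤ D := by positivity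
      rw [← abs_of_nonneg hD0, ← abs_mul, this]
      refine abs_sum_mul_le (by positivity) hc fun i => ?_
      rw [abs_mul, abs_of_nonneg hD0]
      exact (hw i).le
    have hp0' : (0 : ℤ) < p := by exact_mod_cast hp0
    have h2 : |s| * D < p * D := by
      refine h1.trans_lt ?_
      rw [hD]; push_cast; nlinarith
    exact lt_of_mul_lt_mul_right h2 (by positivity)
  rw [← intCast_zmod_eq_zero_iff_of_abs_lt hlt]
  have hab' : a - b ≠ 0 := sub_ne_zero.mpr hab
  have : ((∑ i, c i • (((a * v i).val : ℤ) - (b * v i).val) : ℤ) : ZMod p) =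
      (a - b) * ∑ i, c i • v i := by
    push_cast
    rw [Finset.mul_sum]
    refine Finset.sum_congr rfl fun i _ => ?_
    simp only [zsmul_eq_mul, smul_eq_mul]
    push_cast
    rw [ZMod.natCast_zmod_val, ZMod.natCast_zmod_val]
    ring
  rw [this, mul_eq_zero, or_iff_right hab']

/-- The relations of bounded height among the entries of an integer tuple are already realized by
a tuple of bounded size. -/
theorem exists_bounded_same_relations (n R : ℕ) : ∃ B : ℕ, ∀ v : Fin n → ℤ, ∃ w : Fin n → ℤ,
    (∀ i, |w i| ≤ B) ∧ ∀ c : Fin n → ℤ, (∀ i, |c i| ≤ R) →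
      (∑ i, c i • v i = 0 ↔ ∑ i, c i • w i = 0) := by
  classical
  let X := Fintype.piFinset fun _ : Fin n => Finset.Icc (-(R : ℤ)) R
  let rel : (Fin n → ℤ) → Finset (Fin n → ℤ) := fun v => X.filter fun c => ∑ i, c i • v i = 0
  -- Only finitely many sets of relations occur, so one representative tuple for each suffices; `B`
  -- dominates all their entries.
  have hfin : (Set.range rel).Finite :=
    (X.powerset.finite_toSet).subset (by
      rintro _ ⟨v, rfl⟩
      exact Finset.mem_coe.mpr (Finset.mem_powerset.mpr (Finset.filter_subset _ _)))
  choose! rep hrep using fun M (hM : M ∈ Set.range rel) => hM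
  refine ⟨∑ M ∈ hfin.toFinset, ∑ i, (rep M i).natAbs, fun v => ⟨rep (rel v), fun i => ?_,
    fun c hc => ?_⟩⟩
  · have h1 : (rep (rel v) i).natAbs ≤ ∑ i, (rep (rel v) i).natAbs :=
      Finset.single_le_sum (f := fun i => (rep (rel v) i).natAbs) (fun _ _ => Nat.zero_le _)
        (Finset.mem_univ i)
    have h2 : ∑ i, (rep (rel v) i).natAbs ≤ ∑ M ∈ hfin.toFinset, ∑ i, (rep M i).natAbs :=
      Finset.single_le_sum (f := fun M => ∑ i, (rep M i).natAbs) (fun _ _ => Nat.zero_le _)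
        (hfin.mem_toFinset.mpr ⟨v, rfl⟩)
    rw [Int.abs_eq_natAbs]
    exact_mod_cast h1.trans h2
  · have hcX : c ∈ X := Fintype.mem_piFinset.mpr fun i => Finset.mem_Icc.mpr (abs_le.mp (hc i))
    have := Finset.ext_iff.mp (hrep (rel v) ⟨v, rfl⟩) c
    simpa [rel, hcX] using this.symm

/-- Once the tuple is bounded by `B`, every relation sum is at most `n * R * B` in absolute value,
so reduction modulo a larger `q` creates no new relation. -/
theorem exists_freimanTransfers_int_zmod (n R : ℕ) : ∃ C : ℕ, ∀ q : ℕ, C ≤ q →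
    FreimanTransfers n R ℤ (ZMod q) := by
  obtain ⟨B, hB⟩ := exists_bounded_same_relations n R
  refine ⟨n * R * B + 1, fun q hq v => ?_⟩
  obtain ⟨w, hw, hvw⟩ := hB v
  refine ⟨fun i => (w i : ZMod q), fun c hc => (hvw c hc).trans ?_⟩
  have hlt : |∑ i, c i • w i| < q := by
    have := abs_sum_mul_le (by positivity) hc hw
    simp only [smul_eq_mul]
    refine this.trans_lt ?_
    exact_mod_cast hq
  rw [← intCast_zmod_eq_zero_iff_of_abs_lt hlt]
  push_cast
  simp

/-- A single threshold for rectification and its converse for all tuples of length at most `N`. -/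
theorem exists_freimanTransfers_threshold (N R : ℕ) : ∃ C : ℕ, ∀ n ≤ N,
    (∀ (p : ℕ) [Fact p.Prime], C ≤ p → FreimanTransfers n R (ZMod p) ℤ) ∧
    (∀ q : ℕ, C ≤ q → FreimanTransfers n R ℤ (ZMod q)) := by
  choose C hC using fun n => exists_freimanTransfers_int_zmod n R
  refine ⟨∑ n ∈ Finset.range (N + 1), (C n + ((n * R + 1) ^ n + 1)), fun n hn => ?_⟩
  have hle := Finset.single_le_sum (f := fun n => C n + ((n * R + 1) ^ n + 1))
    (fun _ _ => Nat.zero_le _)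
    (show n ∈ Finset.range (N + 1) from Finset.mem_range.mpr (by omega))
  exact ⟨fun p _ hp => freimanTransfers_zmod_int n R p (by omega), fun q hq => hC n q (by omega)⟩

/-! ### Finite sets almost invariant under few translations -/

/-- The normalized autocorrelation `γ ↦ |A ∩ (A + γ)| / |A|` of a finite set. -/
noncomputable def autocorr {Γ : Type*} [AddCommGroup Γ] [DecidableEq Γ] (A : Finset Γ) (γ : Γ) : ℝ :=
  ((A ×ˢ A).filter fun p => p.1 - p.2 = γ).card / A.card

theorem autocorr_nonneg {Γ : Type*} [AddCommGroup Γ] [DecidableEq Γ] (A : Finset Γ) (γ : Γ) :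
    0 ≤ autocorr A γ := by unfold autocorr; positivity

theorem card_filter_sub_eq {Γ : Type*} [AddCommGroup Γ] [DecidableEq Γ] (A : Finset Γ) (γ : Γ) :
    ((A ×ˢ A).filter fun p => p.1 - p.2 = γ).card = (A ∩ A.image (· + γ)).card := by
  refine Finset.card_bij (fun p _ => p.1) ?_ ?_ ?_
  · rintro ⟨a, b⟩ h
    simp only [Finset.mem_filter, Finset.mem_product] at h
    simp only [Finset.mem_inter, Finset.mem_image]
    exact ⟨h.1.1, b, h.1.2, by rw [← h.2]; abel⟩
  · rintro ⟨a, b⟩ h ⟨a', b'⟩ h' (rfl : a = a')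
    simp only [Finset.mem_filter] at h h'
    have := h.2.trans h'.2.symm
    simpa using this
  · intro a ha
    simp only [Finset.mem_inter, Finset.mem_image] at ha
    obtain ⟨ha, b, hb, rfl⟩ := ha
    exact ⟨(b + γ, b), by simp [ha, hb], rfl⟩

theorem autocorr_le_one {Γ : Type*} [AddCommGroup Γ] [DecidableEq Γ] (A : Finset Γ) (γ : Γ) :
    autocorr A γ ≤ 1 := by
  unfold autocorr
  rw [card_filter_sub_eq]
  refine div_le_one_of_le₀ ?_ (by positivity)
  exact_mod_cast Finset.card_le_card Finset.inter_subset_left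

theorem exists_pow_lt_one_add_pow (m : ℕ) {δ : ℝ} (hδ : 0 < δ) :
    ∃ P : ℕ, ((P : ℝ) + 1) ^ m < (1 + δ) ^ P := by
  have h := tendsto_pow_const_div_const_pow_of_one_lt m (show 1 < 1 + δ by linarith)
  have h' := (h.comp (Filter.tendsto_add_atTop_nat 1)).eventually
    (gt_mem_nhds (show (0 : ℝ) < (1 + δ)⁻¹ by positivity))
  obtain ⟨P, hP⟩ := h'.exists
  refine ⟨P, ?_⟩
  simp only [Function.comp] at hP
  rw [div_lt_iff₀ (by positivity), pow_succ', inv_mul_cancel_left₀ (by positivity)] at hP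
  exact_mod_cast hP

/-- Small finite sets that are almost invariant under a given bounded number of translations. -/
theorem exists_autocorr_ge (m : ℕ) {δ : ℝ} (hδ : 0 < δ) : ∃ N : ℕ,
    ∀ (Γ : Type) [AddCommGroup Γ] [DecidableEq Γ] (S : Finset Γ), S.card ≤ m →
      ∃ A : Finset Γ, A.Nonempty ∧ A.card ≤ N ∧ ∀ γ ∈ S, 1 - δ ≤ autocorr A γ := by
  obtain ⟨P, hP⟩ := exists_pow_lt_one_add_pow m hδ
  refine ⟨(P + 1) ^ m, fun Γ _ _ S hS => ?_⟩
  -- The generalized progressions spanned by `S`: nested, of polynomial size in `n`, and a translate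
  -- of `Q n` by an element of `S` stays in `Q (n + 1)`.
  let Q : ℕ → Finset Γ := fun n =>
    (Fintype.piFinset fun _ : S => Finset.range (n + 1)).image fun c => ∑ s : S, c s • (s : Γ)
  have hcard : ∀ n, (Q n).card ≤ (n + 1) ^ m := fun n => by
    refine Finset.card_image_le.trans ?_
    rw [Fintype.card_piFinset]
    simpa using Nat.pow_le_pow_right (Nat.succ_pos n) hS
  have hpos : ∀ n, (Q n).Nonempty := fun n =>
    Finset.Nonempty.image ⟨0, by simp⟩ _
  have hmono : ∀ n, Q n ⊆ Q (n + 1) := fun n =>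
    Finset.image_subset_image (Fintype.piFinset_subset _ _ fun _ =>
      Finset.range_subset_range.mpr (by omega))
  have hshift : ∀ n, ∀ γ ∈ S, (Q n).image (· + γ) ⊆ Q (n + 1) := by
    intro n γ hγ x hx
    simp only [Q, Finset.mem_image, Fintype.mem_piFinset, Finset.mem_range] at hx ⊢
    obtain ⟨_, ⟨c, hc, rfl⟩, rfl⟩ := hx
    refine ⟨c + Pi.single ⟨γ, hγ⟩ 1, fun s => ?_, ?_⟩
    · have := hc s
      rw [Pi.add_apply]
      have h1 : (Pi.single ⟨γ, hγ⟩ 1 : S → ℕ) s ≤ 1 := by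
        rw [Pi.single_apply]; split_ifs <;> omega
      omega
    · simp only [Pi.add_apply, add_smul, Finset.sum_add_distrib]
      congr 1
      rw [Finset.sum_eq_single (⟨γ, hγ⟩ : S)] <;> simp +contextual
  -- If each of the first `P` steps grew by a factor above `1 + δ`, the exponential lower bound
  -- would overtake the polynomial upper bound.
  obtain ⟨n, hnP, hn⟩ : ∃ n < P, ((Q (n + 1)).card : ℝ) ≤ (1 + δ) * (Q n).card := by
    by_contra! hcon
    have hind : ∀ n ≤ P, (1 + δ) ^ n ≤ ((Q n).card : ℝ) := by
      intro n
      induction n with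
      | zero => intro _; simpa using (hpos 0)
      | succ n ih =>
        intro hn
        have := hcon n (by omega)
        have := ih (by omega)
        rw [pow_succ']
        nlinarith
    have h1 := hind P le_rfl
    have h2 : ((Q P).card : ℝ) ≤ ((P : ℝ) + 1) ^ m := by exact_mod_cast hcard P
    linarith
  refine ⟨Q n, hpos n, (hcard n).trans (Nat.pow_le_pow_left (by omega) m), fun γ hγ => ?_⟩
  have hQ : (0 : ℝ) < (Q n).card := by exact_mod_cast (hpos n).card_pos
  unfold autocorr
  rw [card_filter_sub_eq, le_div_iff₀ hQ]
  -- Inclusion–exclusion: the union lies in `Q (n + 1)`, so the intersection has at least `2|Q n| -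
  -- (1 + δ)|Q n|` elements.
  have h1 := Finset.card_union_add_card_inter (Q n) ((Q n).image (· + γ))
  rw [Finset.card_image_of_injective _ (add_left_injective γ)] at h1
  have h2 := Finset.card_le_card (Finset.union_subset (hmono n) (hshift n γ hγ))
  have h1' : (((Q n ∪ (Q n).image (· + γ)).card : ℝ)) + ((Q n ∩ (Q n).image (· + γ)).card : ℝ) =
    (Q n).card + (Q n).card := by exact_mod_cast h1
  have h2' : ((Q n ∪ (Q n).image (· + γ)).card : ℝ) ≤ (Q (n + 1)).card := by exact_mod_cast h2
  nlinarith

/-! ### Haar measure, characters and Fourier coefficients -/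

section normHaar

variable {G : Type*} [AddCommGroup G] [TopologicalSpace G] [IsTopologicalAddGroup G]
  [CompactSpace G] [MeasurableSpace G] [BorelSpace G]

instance isProbabilityMeasure_normHaar : IsProbabilityMeasure (normHaar G) := ⟨normHaar_univ G⟩

instance isAddHaarMeasure_normHaar : (normHaar G).IsAddHaarMeasure := by
  unfold normHaar; infer_instance

/-- A nontrivial continuous character has mean zero. -/
theorem integral_character_eq_zero {χ : G → ℂ} (hχ : ∀ x y, χ (x + y) = χ x * χ y) {x : G}
    (hx : χ x ≠ 1) : ∫ y, χ y ∂normHaar G = 0 := by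
  have h : ∫ y, χ (x + y) ∂normHaar G = ∫ y, χ y ∂normHaar G :=
    integral_add_left_eq_self (μ := normHaar G) χ x
  simp only [hχ] at h
  rw [integral_const_mul] at h
  have : (χ x - 1) * ∫ y, χ y ∂normHaar G = 0 := by rw [sub_mul, h]; ring
  exact (mul_eq_zero.mp this).resolve_left (sub_ne_zero.mpr hx)

theorem integrable_normHaar_of_bounded {E : Type*} [NormedAddCommGroup E] {f : G → E}
    (hf : AEStronglyMeasurable f (normHaar G)) {C : ℝ} (hC : ∀ x, ‖f x‖ ≤ C) :
    Integrable f (normHaar G) :=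
  Integrable.of_bound hf C (Filter.Eventually.of_forall hC)

end normHaar

/-- A group `Γ` of continuous characters of `G` which is orthonormal and complete. -/
structure CharacterSystem (Γ G : Type*) [AddCommGroup Γ] [AddCommGroup G] [TopologicalSpace G]
    [IsTopologicalAddGroup G] [CompactSpace G] [MeasurableSpace G] [BorelSpace G] where
  /-- the character with a given frequency -/
  char : Γ → G → ℂ
  continuous_char : ∀ γ, Continuous (char γ)
  norm_char : ∀ γ x, ‖char γ x‖ = 1
  char_add_left : ∀ γ γ' x, char (γ + γ') x = char γ x * char γ' x
  char_add_right : ∀ γ x y, char γ (x + y) = char γ x * char γ y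
  eq_zero_of_char_eq_one : ∀ γ, (∀ x, char γ x = 1) → γ = 0
  parseval : ∀ f : G → ℝ, Measurable f → (∀ x, |f x| ≤ 1) →
    HasSum (fun γ => ‖∫ x, (f x : ℂ) * conj (char γ x) ∂normHaar G‖ ^ 2)
      (∫ x, f x ^ 2 ∂normHaar G)

namespace CharacterSystem

variable {Γ G : Type*} [AddCommGroup Γ] [AddCommGroup G] [TopologicalSpace G]
  [IsTopologicalAddGroup G] [CompactSpace G] [MeasurableSpace G] [BorelSpace G]
  (X : CharacterSystem Γ G)

theorem char_ne_zero (γ : Γ) (x : G) : X.char γ x ≠ 0 := by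
  rw [← norm_ne_zero_iff, X.norm_char]; exact one_ne_zero

@[simp] theorem char_zero_left (x : G) : X.char 0 x = 1 := by
  have := X.char_add_left 0 0 x
  rw [add_zero] at this
  exact (mul_eq_left₀ (X.char_ne_zero 0 x)).mp this.symm

@[simp] theorem char_zero_right (γ : Γ) : X.char γ 0 = 1 := by
  have := X.char_add_right γ 0 0
  rw [add_zero] at this
  exact (mul_eq_left₀ (X.char_ne_zero γ 0)).mp this.symm

theorem char_mul_conj (γ : Γ) (x : G) : X.char γ x * conj (X.char γ x) = 1 := by
  rw [Complex.mul_conj, Complex.normSq_eq_norm_sq, X.norm_char]; simp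

theorem char_neg_left (γ : Γ) (x : G) : X.char (-γ) x = conj (X.char γ x) := by
  have h := X.char_add_left γ (-γ) x
  rw [add_neg_cancel, char_zero_left, ← X.char_mul_conj γ x] at h
  exact (mul_left_cancel₀ (X.char_ne_zero γ x) h).symm

theorem char_sub_left (γ γ' : Γ) (x : G) :
    X.char (γ - γ') x = X.char γ x * conj (X.char γ' x) := by
  rw [sub_eq_add_neg, X.char_add_left, X.char_neg_left]

/-- The pairing between frequencies and points as a biadditive map. -/
noncomputable def toAddHom : Γ →+ G →+ Additive ℂˣ where
  toFun γ :=
    { toFun := fun x => Additive.ofMul (Units.mk0 (X.char γ x) (X.char_ne_zero γ x))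
      map_zero' := by
        apply Additive.toMul.injective; ext; simp
      map_add' := fun x y => by
        apply Additive.toMul.injective; ext; simp [X.char_add_right] }
  map_zero' := by
    ext x; simp
  map_add' γ γ' := by
    ext x; simp [X.char_add_left]

theorem toAddHom_apply (γ : Γ) (x : G) :
    (((X.toAddHom γ x).toMul : ℂˣ) : ℂ) = X.char γ x := rfl

theorem char_eq_one_iff {γ : Γ} {x : G} : X.char γ x = 1 ↔ X.toAddHom γ x = 0 := by
  rw [← X.toAddHom_apply, Units.val_eq_one]; rfl

theorem prod_char {ι : Type*} (s : Finset ι) (ψ : ι → Γ) (x : ι → G) :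
    ∏ i ∈ s, X.char (ψ i) (x i) = ((∑ i ∈ s, X.toAddHom (ψ i) (x i)).toMul : ℂˣ) := by
  rw [toMul_sum, Units.coe_prod]
  rfl

/-- Duality: if `c • γ = 0`, then `γ` is trivial on `c • G`, which is all of `G`. -/
theorem smul_injective_of_surjective (X : CharacterSystem Γ G) {c : ℤ} (hc : Function.Surjective fun x : G => c • x) :
    Function.Injective fun γ : Γ => c • γ := by
  have : ∀ γ : Γ, c • γ = 0 → γ = 0 := fun γ hγ => X.eq_zero_of_char_eq_one γ fun x => by
    obtain ⟨y, rfl⟩ := hc x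
    simp only
    rw [X.char_eq_one_iff, map_zsmul, ← AddMonoidHom.zsmul_apply, ← map_zsmul, hγ, map_zero,
      AddMonoidHom.zero_apply]
  intro a b hab
  exact sub_eq_zero.mp (this _ (by rw [smul_sub]; exact sub_eq_zero.mpr hab))

theorem integral_char [DecidableEq Γ] (γ : Γ) :
    ∫ x, X.char γ x ∂normHaar G = if γ = 0 then 1 else 0 := by
  split_ifs with h
  · subst h; simp
  · by_cases h' : ∀ x, X.char γ x = 1
    · exact absurd (X.eq_zero_of_char_eq_one γ h') h
    · push Not at h'
      obtain ⟨x, hx⟩ := h'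
      exact integral_character_eq_zero (X.char_add_right γ) hx

/-- Fourier coefficients. -/
noncomputable def coeff (f : G → ℝ) (γ : Γ) : ℂ :=
  ∫ x, (f x : ℂ) * conj (X.char γ x) ∂normHaar G

theorem measurable_char (γ : Γ) : Measurable (X.char γ) := (X.continuous_char γ).measurable

theorem integrable_mul_char {f : G → ℝ} (hf : Measurable f) {C : ℝ} (hC : ∀ x, |f x| ≤ C) (γ : Γ) :
    Integrable (fun x => (f x : ℂ) * conj (X.char γ x)) (normHaar G) := by
  have := X.measurable_char γ
  refine integrable_normHaar_of_bounded (C := C) (by fun_prop) fun x => ?_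
  rw [norm_mul, RCLike.norm_conj, X.norm_char, mul_one, Complex.norm_real]
  exact hC x

theorem integrable_char (γ : Γ) : Integrable (X.char γ) (normHaar G) :=
  integrable_normHaar_of_bounded (X.measurable_char γ).aestronglyMeasurable
    fun x => (X.norm_char γ x).le

theorem coeff_one [DecidableEq Γ] (γ : Γ) : X.coeff (fun _ => 1) γ = if γ = 0 then 1 else 0 := by
  simp only [coeff, Complex.ofReal_one, one_mul, ← X.char_neg_left]
  rw [X.integral_char]
  simp

theorem coeff_zero (f : G → ℝ) : X.coeff f 0 = ((∫ x, f x ∂normHaar G : ℝ) : ℂ) := by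
  simp only [coeff, char_zero_left, map_one, mul_one]
  exact integral_ofReal

theorem norm_coeff_le {f : G → ℝ} (hf : ∀ x, 0 ≤ f x) (γ : Γ) :
    ‖X.coeff f γ‖ ≤ ∫ x, f x ∂normHaar G := by
  refine (norm_integral_le_integral_norm _).trans_eq (integral_congr_ae ?_)
  refine Filter.Eventually.of_forall fun x => ?_
  simp only [norm_mul, RCLike.norm_conj, X.norm_char, mul_one, Complex.norm_real]
  exact abs_of_nonneg (hf x)

end CharacterSystem

/-! ### The solution functional and its continuity in mean -/

namespace IntLinearForm

variable {t : ℕ} (L : IntLinearForm t)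

theorem exists_multiplier (hL : L.HasCoprimeCoeffs) : ∃ n : Fin t → ℤ,
    ∑ i, n i * L.coeff i = 1 ∧ ∑ i, (n i).natAbs = L.multiplierHeight := by
  have hne : {m : ℕ | ∃ n : Fin t → ℤ, ∑ i, n i * L.coeff i = 1 ∧
      ∑ i, (n i).natAbs = m}.Nonempty := by
    obtain ⟨n, hn⟩ := Finset.gcd_eq_sum_mul Finset.univ L.coeff
    refine ⟨_, n, ?_, rfl⟩
    rw [show Finset.univ.gcd L.coeff = 1 from hL] at hn
    rw [hn]
    exact Finset.sum_congr rfl fun i _ => mul_comm _ _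
  exact Nat.sInf_mem hne

theorem mem_ker_iff {G : Type*} [AddCommGroup G] {x : Fin t → G} :
    x ∈ L.ker G ↔ ∑ i, L.coeff i • x i = 0 := Iff.rfl

theorem continuous_coord {G : Type*} [AddCommGroup G] [TopologicalSpace G] (i : Fin t) :
    Continuous fun x : L.ker G => x.1 i :=
  (continuous_apply i).comp continuous_subtype_val

section Topology

variable {G : Type*} [AddCommGroup G] [TopologicalSpace G] [IsTopologicalAddGroup G]
  [CompactSpace G] [T2Space G] [SecondCountableTopology G] [MeasurableSpace G] [BorelSpace G]

/-- The coordinate projections `ker L → G` preserve Haar measure. -/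
theorem measurePreserving_coord (ht : 2 ≤ t) (hL : L.IsAdmissible G) (i : Fin t) :
    MeasurePreserving (fun x : L.ker G => x.1 i) (normHaar (L.ker G)) (normHaar G) := by
  have hsurj : Function.Surjective fun x : L.ker G => x.1 i := by
    intro y
    obtain ⟨j, hj⟩ : ∃ j : Fin t, j ≠ i := by
      have : Nontrivial (Fin t) := Fin.nontrivial_iff_two_le.mpr ht
      exact exists_ne i
    -- A second coordinate `j` absorbs the prescribed value `y`, so the projection is onto; a
    -- continuous surjective homomorphism carries one normalized Haar measure to the other.
    obtain ⟨z, hz⟩ := hL j (-(L.coeff i • y))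
    refine ⟨⟨Pi.single i y + Pi.single j z, ?_⟩, ?_⟩
    · rw [mem_ker_iff]
      simp only [Pi.add_apply, smul_add, Finset.sum_add_distrib]
      rw [Finset.sum_eq_single i (fun k _ hk => by simp [hk]) (by simp),
        Finset.sum_eq_single j (fun k _ hk => by simp [hk]) (by simp)]
      simp only [Pi.single_eq_same]
      rw [show L.coeff j • z = -(L.coeff i • y) from hz, add_neg_cancel]
    · simp [hj.symm]
  let p : L.ker G →+ G := (Pi.evalAddMonoidHom (fun _ : Fin t => G) i).comp (L.ker G).subtype
  exact AddMonoidHom.measurePreserving (f := p) (L.continuous_coord i) hsurj (by simp)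

theorem sol_ofReal (f : Fin t → G → ℝ) :
    ((L.sol f : ℝ) : ℂ) = L.sol fun i x => (f i x : ℂ) := by
  unfold sol
  rw [← integral_complex_ofReal]
  simp

end Topology

end IntLinearForm

theorem abs_prod_sub_prod_le {ι : Type*} (s : Finset ι) {a b : ι → ℝ} (ha : ∀ i ∈ s, |a i| ≤ 1)
    (hb : ∀ i ∈ s, |b i| ≤ 1) : |∏ i ∈ s, a i - ∏ i ∈ s, b i| ≤ ∑ i ∈ s, |a i - b i| := by
  classical
  induction s using Finset.induction_on with
  | empty => simp
  | insert j s hj ih =>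
    rw [Finset.prod_insert hj, Finset.prod_insert hj, Finset.sum_insert hj]
    have ih' := ih (fun i hi => ha i (Finset.mem_insert_of_mem hi))
      (fun i hi => hb i (Finset.mem_insert_of_mem hi))
    have h1 : |∏ i ∈ s, a i| ≤ 1 := by
      rw [Finset.abs_prod]
      exact Finset.prod_le_one (fun _ _ => abs_nonneg _)
        fun i hi => ha i (Finset.mem_insert_of_mem hi)
    have h2 := hb j (Finset.mem_insert_self _ _)
    calc |a j * ∏ i ∈ s, a i - b j * ∏ i ∈ s, b i|
        = |(a j - b j) * ∏ i ∈ s, a i + b j * (∏ i ∈ s, a i - ∏ i ∈ s, b i)| := by ring_nf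
      _ ≤ |a j - b j| * |∏ i ∈ s, a i| + |b j| * |∏ i ∈ s, a i - ∏ i ∈ s, b i| := by
          rw [← abs_mul, ← abs_mul]; exact abs_add_le _ _
      _ ≤ _ := by
          have := abs_nonneg (a j - b j)
          have := abs_nonneg (∏ i ∈ s, a i - ∏ i ∈ s, b i)
          nlinarith

namespace IntLinearForm

variable {t : ℕ} (L : IntLinearForm t) {G : Type*} [AddCommGroup G]
  [TopologicalSpace G] [IsTopologicalAddGroup G] [CompactSpace G] [T2Space G]
  [SecondCountableTopology G] [MeasurableSpace G] [BorelSpace G]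

theorem integrable_prod_coord {f : G → ℝ} (hf : Measurable f) (hf1 : ∀ x, |f x| ≤ 1) :
    Integrable (fun x : L.ker G => ∏ i, f (x.1 i)) (normHaar (L.ker G)) := by
  refine integrable_normHaar_of_bounded (C := 1) (Measurable.aestronglyMeasurable ?_) fun x => ?_
  · exact Finset.measurable_prod _ fun i _ => hf.comp (L.continuous_coord i).measurable
  · rw [Real.norm_eq_abs, Finset.abs_prod]
    exact Finset.prod_le_one (fun _ _ => abs_nonneg _) fun i _ => hf1 _

theorem integrable_coord (ht : 2 ≤ t) (hL : L.IsAdmissible G) {u : G → ℝ}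
    (hu : Integrable u (normHaar G)) (i : Fin t) :
    Integrable (fun x : L.ker G => u (x.1 i)) (normHaar (L.ker G)) :=
  (L.measurePreserving_coord ht hL i).integrable_comp_of_integrable hu

theorem integral_coord (ht : 2 ≤ t) (hL : L.IsAdmissible G) {u : G → ℝ}
    (hu : Measurable u) (i : Fin t) :
    ∫ x : L.ker G, u (x.1 i) ∂normHaar (L.ker G) = ∫ x, u x ∂normHaar G := by
  have h := L.measurePreserving_coord ht hL i
  rw [← h.map_eq, integral_map h.measurable.aemeasurable hu.aestronglyMeasurable]

/-- Replacing the factors one at a time costs `|f - g|` at each coordinate, and each coordinate is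
Haar-distributed on `G`. -/
theorem abs_sol_sub_sol_le (ht : 2 ≤ t) (hL : L.IsAdmissible G) {f g : G → ℝ} (hf : Measurable f)
    (hg : Measurable g) (hf1 : ∀ x, |f x| ≤ 1) (hg1 : ∀ x, |g x| ≤ 1) :
    |L.sol (fun _ => f) - L.sol (fun _ => g)| ≤ t * ∫ x, |f x - g x| ∂normHaar G := by
  have hu : Measurable fun x => |f x - g x| := by fun_prop
  have hint : Integrable (fun x : G => |f x - g x|) (normHaar G) :=
    integrable_normHaar_of_bounded hu.aestronglyMeasurable (C := 2) fun x => by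
      rw [Real.norm_eq_abs, abs_abs]
      linarith [abs_sub (f x) (g x), hf1 x, hg1 x]
  have hint2 : ∀ i ∈ Finset.univ, Integrable (fun x : L.ker G => |f (x.1 i) - g (x.1 i)|)
      (normHaar (L.ker G)) := fun i _ => L.integrable_coord ht hL hint i
  have hdiff := (L.integrable_prod_coord hf hf1).sub (L.integrable_prod_coord hg hg1)
  unfold sol
  rw [← integral_sub (L.integrable_prod_coord hf hf1) (L.integrable_prod_coord hg hg1)]
  refine abs_integral_le_integral_abs.trans ?_
  refine (integral_mono hdiff.abs (integrable_finsetSum _ hint2) fun x =>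
    abs_prod_sub_prod_le _ (fun i _ => hf1 _) fun i _ => hg1 _).trans_eq ?_
  rw [integral_finsetSum _ hint2, Finset.sum_congr rfl fun i _ => L.integral_coord ht hL hu i]
  simp

end IntLinearForm

/-! ### Transfer of a function along a relabelling of frequencies -/

namespace CharacterSystem

variable {Γ G : Type*} [AddCommGroup Γ] [AddCommGroup G] [TopologicalSpace G]
  [IsTopologicalAddGroup G] [CompactSpace G] [MeasurableSpace G] [BorelSpace G]
  (X : CharacterSystem Γ G)
  {Γ' H : Type*} [AddCommGroup Γ'] [AddCommGroup H] [TopologicalSpace H]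
  [IsTopologicalAddGroup H] [CompactSpace H] [MeasurableSpace H] [BorelSpace H]
  (Y : CharacterSystem Γ' H)

/-- The function on `H` obtained from `f` by smoothing with the kernel of the finite set `A` and
relabelling the frequencies by `φ`. -/
noncomputable def transfer (A : Finset Γ) (φ : Γ → Γ') (f : G → ℝ) (x : H) : ℝ :=
  ∫ y, f y * (‖∑ a ∈ A, conj (X.char a y) * Y.char (φ a) x‖ ^ 2 / A.card) ∂normHaar G

/-- Expand the squared norm. Indexing by pairs from `A`, rather than by differences, means that `φ`
never has to be extended to `A - A`. -/
theorem transfer_eq_sum (A : Finset Γ) (φ : Γ → Γ') {f : G → ℝ} (hf : Measurable f) {C : ℝ}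
    (hC : ∀ x, |f x| ≤ C) (x : H) :
    (X.transfer Y A φ f x : ℂ) =
      ∑ p ∈ A ×ˢ A, X.coeff f (p.1 - p.2) / A.card * Y.char (φ p.1 - φ p.2) x := by
  have hpt : ∀ y, ((f y * (‖∑ a ∈ A, conj (X.char a y) * Y.char (φ a) x‖ ^ 2 / A.card) : ℝ) : ℂ) =
      ∑ p ∈ A ×ˢ A, ((f y : ℂ) * conj (X.char (p.1 - p.2) y)) *
        (Y.char (φ p.1 - φ p.2) x / A.card) := by
    intro y
    push_cast
    rw [← Complex.mul_conj', map_sum, Finset.sum_mul_sum, ← Finset.sum_product', Finset.sum_div,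
      Finset.mul_sum]
    refine Finset.sum_congr rfl fun p _ => ?_
    simp only [char_sub_left, map_mul, Complex.conj_conj]
    ring
  rw [transfer, ← integral_complex_ofReal]
  simp only [hpt]
  rw [integral_finsetSum _ fun p _ => (X.integrable_mul_char hf hC _).mul_const _]
  refine Finset.sum_congr rfl fun p _ => ?_
  rw [integral_mul_const, coeff]
  ring

theorem continuous_transfer (A : Finset Γ) (φ : Γ → Γ') {f : G → ℝ} (hf : Measurable f) {C : ℝ}
    (hC : ∀ x, |f x| ≤ C) : Continuous (X.transfer Y A φ f) := by
  have h : X.transfer Y A φ f = fun x =>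
      (∑ p ∈ A ×ˢ A, X.coeff f (p.1 - p.2) / A.card * Y.char (φ p.1 - φ p.2) x).re := by
    ext x
    rw [← X.transfer_eq_sum Y A φ hf hC, Complex.ofReal_re]
  rw [h]
  refine Complex.continuous_re.comp (continuous_finsetSum _ fun p _ => ?_)
  exact continuous_const.mul (Y.continuous_char _)

theorem sum_diagonal_div_card {Γ : Type*} [AddCommGroup Γ] [DecidableEq Γ] {A : Finset Γ}
    (hA : A.Nonempty) {z : ℂ} :
    ∑ p ∈ A ×ˢ A, (if p.1 = p.2 then z / A.card else 0) = z := by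
  rw [Finset.sum_product]
  have : (A.card : ℂ) ≠ 0 := by exact_mod_cast hA.card_pos.ne'
  simp only [Finset.sum_ite_eq]
  rw [Finset.sum_congr rfl fun a ha => if_pos ha]
  simp
  field_simp

/-- The constant `1` has only the zero frequency, so only diagonal pairs survive, whatever `φ` is.
With positivity of the kernel this keeps transferred functions in `[0,1]`. -/
theorem transfer_one {A : Finset Γ} (hA : A.Nonempty) (φ : Γ → Γ') (x : H) :
    X.transfer Y A φ (fun _ => 1) x = 1 := by
  classical
  have h := X.transfer_eq_sum Y A φ (f := fun _ => 1) measurable_const (C := 1) (by simp) x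
  have h2 : ∑ p ∈ A ×ˢ A, X.coeff (fun _ => 1) (p.1 - p.2) / A.card * Y.char (φ p.1 - φ p.2) x =
      ∑ p ∈ A ×ˢ A, (if p.1 = p.2 then 1 / (A.card : ℂ) else 0) := by
    refine Finset.sum_congr rfl fun p _ => ?_
    rw [X.coeff_one, sub_eq_zero]
    split_ifs with hp
    · simp [hp]
    · simp
  rw [h2, sum_diagonal_div_card hA] at h
  exact_mod_cast h

theorem continuous_transfer_kernel (A : Finset Γ) (φ : Γ → Γ') (x : H) :
    Continuous fun y => ‖∑ a ∈ A, conj (X.char a y) * Y.char (φ a) x‖ ^ 2 / (A.card : ℝ) := by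
  refine ((Continuous.norm ?_).pow 2).div_const _
  refine continuous_finsetSum _ fun a _ => ?_
  exact (Complex.continuous_conj.comp (X.continuous_char a)).mul continuous_const

theorem integrable_mul_transfer_kernel (A : Finset Γ) (φ : Γ → Γ') {f : G → ℝ} (hf : Measurable f)
    {C : ℝ} (hC : ∀ x, |f x| ≤ C) (x : H) :
    Integrable (fun y => f y * (‖∑ a ∈ A, conj (X.char a y) * Y.char (φ a) x‖ ^ 2 / A.card))
      (normHaar G) := by
  have hc := X.continuous_transfer_kernel Y A φ x
  obtain ⟨D, hD⟩ := isCompact_univ.exists_bound_of_continuousOn hc.continuousOn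
  refine integrable_normHaar_of_bounded (C := C * D) ?_ fun y => ?_
  · exact (hf.mul hc.measurable).aestronglyMeasurable
  · rw [norm_mul]
    exact mul_le_mul (hC y) (hD y (Set.mem_univ y)) (norm_nonneg _) ((abs_nonneg _).trans (hC y))

theorem transfer_mem_Icc {A : Finset Γ} (hA : A.Nonempty) (φ : Γ → Γ') {f : G → ℝ}
    (hf : Measurable f) (hf1 : ∀ x, f x ∈ Set.Icc (0 : ℝ) 1) (x : H) :
    X.transfer Y A φ f x ∈ Set.Icc (0 : ℝ) 1 := by
  have hC : ∀ x, |f x| ≤ 1 := fun x => abs_le.mpr ⟨by linarith [(hf1 x).1], (hf1 x).2⟩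
  constructor
  · exact integral_nonneg fun y => mul_nonneg (hf1 y).1 (by positivity)
  · rw [← X.transfer_one Y hA φ x]
    refine integral_mono (X.integrable_mul_transfer_kernel Y A φ hf hC x)
      (X.integrable_mul_transfer_kernel Y A φ measurable_const (C := 1) (by simp) x) fun y => ?_
    exact mul_le_mul_of_nonneg_right (hf1 y).2 (by positivity)

/-- Injectivity of `φ` ensures that off-diagonal pairs do not acquire frequency zero on `H`. -/
theorem integral_transfer {A : Finset Γ} (hA : A.Nonempty) {φ : Γ → Γ'}
    (hφ : Set.InjOn φ A) {f : G → ℝ} (hf : Measurable f) {C : ℝ} (hC : ∀ x, |f x| ≤ C) :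
    ∫ x, X.transfer Y A φ f x ∂normHaar H = ∫ x, f x ∂normHaar G := by
  classical
  have h : ((∫ x, X.transfer Y A φ f x ∂normHaar H : ℝ) : ℂ) =
      ((∫ x, f x ∂normHaar G : ℝ) : ℂ) := by
    rw [← integral_complex_ofReal]
    simp only [X.transfer_eq_sum Y A φ hf hC]
    rw [integral_finsetSum _ fun p _ => (Y.integrable_char _).const_mul _]
    rw [← X.coeff_zero, ← sum_diagonal_div_card hA (z := X.coeff f 0)]
    refine Finset.sum_congr rfl fun p hp => ?_
    rw [integral_const_mul, Y.integral_char, sub_eq_zero]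
    rw [Finset.mem_product] at hp
    by_cases h : p.1 = p.2
    · simp [h]
    · rw [if_neg h, if_neg fun h' => h (hφ hp.1 hp.2 h'), mul_zero]
  exact_mod_cast h

section Solutions

variable [T2Space G] [SecondCountableTopology G] [T2Space H] [SecondCountableTopology H]
  {t : ℕ} (L : IntLinearForm t)

-- A character of `Gᵗ` has mean `1` or `0` on `ker L` according to whether it is trivial there.
-- Coprimality identifies the trivial ones, with `r = ∑ n_i ψ_i` for a Bézout multiplier `n`.
open scoped Classical in
theorem sol_char (hL : L.HasCoprimeCoeffs) (ψ : Fin t → Γ) :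
    L.sol (fun i => X.char (ψ i)) = if ∃ r : Γ, ∀ i, ψ i = L.coeff i • r then 1 else 0 := by
  unfold IntLinearForm.sol
  simp only [X.prod_char]
  split_ifs with h
  · obtain ⟨r, hr⟩ := h
    have : ∀ x : L.ker G, ∑ i, X.toAddHom (ψ i) (x.1 i) = 0 := fun x => by
      have hx := L.mem_ker_iff.mp x.2
      simp only [hr, map_zsmul, AddMonoidHom.zsmul_apply]
      simp only [← map_zsmul]
      rw [← map_sum, hx, map_zero]
    simp [this]
  · have hχ : ∃ x : L.ker G, ∑ i, X.toAddHom (ψ i) (x.1 i) ≠ 0 := by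
      by_contra! hcon
      obtain ⟨n, hn, -⟩ := L.exists_multiplier hL
      refine h ⟨∑ i, n i • ψ i, fun j => ?_⟩
      rw [← sub_eq_zero]
      refine X.eq_zero_of_char_eq_one _ fun x => X.char_eq_one_iff.mpr ?_
      -- Since `∑ n_i c_i = 1`, this test vector lies in the kernel; evaluating the character there
      -- compares `ψ j` with `c_j r`.
      have hmem : (Pi.single j x - fun i => (n i * L.coeff j) • x) ∈ L.ker G := by
        rw [L.mem_ker_iff]
        simp only [Pi.sub_apply, smul_sub, Finset.sum_sub_distrib]
        rw [Finset.sum_eq_single j (fun k _ hk => by simp [hk]) (by simp), Pi.single_eq_same]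
        simp only [smul_smul]
        rw [← Finset.sum_smul]
        have : ∑ i, L.coeff i * (n i * L.coeff j) = L.coeff j := by
          calc ∑ i, L.coeff i * (n i * L.coeff j) = (∑ i, n i * L.coeff i) * L.coeff j := by
                rw [Finset.sum_mul]
                exact Finset.sum_congr rfl fun i _ => by ring
            _ = L.coeff j := by rw [hn, one_mul]
        rw [this, sub_self]
      have := hcon ⟨_, hmem⟩
      simp only [Pi.sub_apply, map_sub, Finset.sum_sub_distrib] at this
      rw [Finset.sum_eq_single j (fun k _ hk => by simp [hk]) (by simp), Pi.single_eq_same] at this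
      rw [map_sub, AddMonoidHom.sub_apply, ← this, Finset.smul_sum, map_sum,
        AddMonoidHom.finsetSum_apply]
      simp only [smul_smul, map_zsmul, AddMonoidHom.zsmul_apply, mul_comm]
    obtain ⟨x, hx⟩ := hχ
    refine integral_character_eq_zero (x := x) (fun y z => ?_) ?_
    · simp [Finset.sum_add_distrib]
    · rw [Ne, Units.val_eq_one]
      exact hx

open scoped Classical in
/-- The solution count of a trigonometric polynomial. -/
theorem sol_sum_char (hL : L.HasCoprimeCoeffs) {J : Type*} (s : Finset J) (w : J → ℂ) (ψ : J → Γ) :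
    L.sol (fun _ x => ∑ j ∈ s, w j * X.char (ψ j) x) =
      ∑ j ∈ Fintype.piFinset fun _ : Fin t => s,
        if ∃ r : Γ, ∀ i, ψ (j i) = L.coeff i • r then ∏ i, w (j i) else 0 := by
  have h1 : ∀ j : Fin t → J, L.sol (fun i => X.char (ψ (j i))) =
      if ∃ r : Γ, ∀ i, ψ (j i) = L.coeff i • r then 1 else 0 := fun j => X.sol_char L hL _
  have h2 : ∀ x : L.ker G, ∏ i, ∑ j ∈ s, w j * X.char (ψ j) (x.1 i) =
      ∑ j ∈ Fintype.piFinset fun _ : Fin t => s,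
        (∏ i, w (j i)) * ∏ i, X.char (ψ (j i)) (x.1 i) := fun x => by
    rw [Finset.prod_univ_sum]
    exact Finset.sum_congr rfl fun j _ => Finset.prod_mul_distrib
  unfold IntLinearForm.sol at h1 ⊢
  simp only [h2]
  rw [integral_finsetSum]
  · refine Finset.sum_congr rfl fun j _ => ?_
    rw [integral_const_mul, h1]
    simp
  · intro j _
    refine Integrable.const_mul ?_ _
    refine integrable_normHaar_of_bounded (C := 1) (Continuous.aestronglyMeasurable ?_) fun x => ?_
    · exact continuous_finsetProd _ fun i _ => (X.continuous_char _).comp (L.continuous_coord i)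
    · simp [norm_prod, X.norm_char]

end Solutions

end CharacterSystem

/-! ### Resonant tuples as bounded integer relations -/

/-- A Bézout multiplier recovers `r` as `∑ n_i ψ_i`, which turns an existential over the group into
explicit integer relations. -/
theorem exists_smul_eq_iff {t : ℕ} (L : IntLinearForm t) {n : Fin t → ℤ}
    (hn : ∑ i, n i * L.coeff i = 1) {M : Type*} [AddCommGroup M] (ψ : Fin t → M) :
    (∃ r : M, ∀ i, ψ i = L.coeff i • r) ↔
      ∀ j, ψ j - L.coeff j • ∑ i, n i • ψ i = 0 := by
  constructor
  · rintro ⟨r, hr⟩ j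
    have : ∑ i, n i • ψ i = r := by
      simp only [hr, smul_smul]
      rw [← Finset.sum_smul, hn, one_smul]
    rw [this, hr, sub_self]
  · exact fun h => ⟨_, fun j => sub_eq_zero.mp (h j)⟩

/-- `φ` preserves and reflects the linear relations of height at most `R` among elements of `A`. -/
def PreservesRelations {Γ Γ' : Type*} [AddCommGroup Γ] [AddCommGroup Γ'] (R : ℕ) (A : Finset Γ)
    (φ : Γ → Γ') : Prop :=
  ∀ c : Γ → ℤ, (∀ a, |c a| ≤ R) → (∑ a ∈ A, c a • a = 0 ↔ ∑ a ∈ A, c a • φ a = 0)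

theorem FreimanTransfers.exists_preservesRelations {R : ℕ} {Γ Γ' : Type*} [AddCommGroup Γ]
    [AddCommGroup Γ'] {A : Finset Γ} (h : FreimanTransfers A.card R Γ Γ') :
    ∃ φ : Γ → Γ', PreservesRelations R A φ := by
  classical
  let e := A.equivFin
  obtain ⟨w, hw⟩ := h fun i => (e.symm i : Γ)
  let φ : Γ → Γ' := fun a => if ha : a ∈ A then w (e ⟨a, ha⟩) else 0
  refine ⟨φ, fun c hc => ?_⟩
  have key := hw (fun i => c (e.symm i)) fun i => hc _
  have h1 : ∑ a ∈ A, c a • a = ∑ i, c (e.symm i) • (e.symm i : Γ) := by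
    rw [← Finset.sum_coe_sort A]
    exact (Equiv.sum_comp e.symm fun a : A => c a • (a : Γ)).symm
  have h2 : ∑ a ∈ A, c a • φ a = ∑ i, c (e.symm i) • w i := by
    rw [← Finset.sum_coe_sort A, ← Equiv.sum_comp e.symm]
    exact Finset.sum_congr rfl fun i _ => by simp [φ]
  rw [h1, h2, key]

section Relations

variable {Γ Γ' : Type*} [AddCommGroup Γ'] [DecidableEq Γ] {R : ℕ} {A : Finset Γ}

/-- The coefficient vector of `a - b`. -/
def differenceVector (p : Γ × Γ) : Γ → ℤ := Pi.single p.1 1 - Pi.single p.2 1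

theorem abs_differenceVector_le (p : Γ × Γ) (a : Γ) : |differenceVector p a| ≤ 1 := by
  simp only [differenceVector, Pi.sub_apply, Pi.single_apply]
  split_ifs <;> simp

theorem sum_differenceVector_smul {p : Γ × Γ} (hp : p ∈ A ×ˢ A) (φ : Γ → Γ') :
    ∑ a ∈ A, differenceVector p a • φ a = φ p.1 - φ p.2 := by
  rw [Finset.mem_product] at hp
  simp only [differenceVector, Pi.sub_apply, Pi.single_apply, sub_smul, Finset.sum_sub_distrib,
    ite_smul, one_smul, zero_smul, Finset.sum_ite_eq', hp.1, hp.2, if_true]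

theorem PreservesRelations.injOn [AddCommGroup Γ] {φ : Γ → Γ'} (h : PreservesRelations R A φ) (hR : 1 ≤ R) :
    Set.InjOn φ A := by
  intro a ha b hb hab
  have hp : (a, b) ∈ A ×ˢ A := Finset.mem_product.mpr ⟨ha, hb⟩
  have key := h (differenceVector (a, b)) fun x =>
    (abs_differenceVector_le _ x).trans (by exact_mod_cast hR)
  rw [sum_differenceVector_smul hp φ] at key
  have h1 := sum_differenceVector_smul hp (id : Γ → Γ)
  simp only [id] at h1
  rw [h1] at key
  exact sub_eq_zero.mp (key.mpr (sub_eq_zero.mpr hab))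

theorem sum_relation_smul {M : Type*} [AddCommGroup M] {t : ℕ} {p : Fin t → Γ × Γ}
    (hp : ∀ i, p i ∈ A ×ˢ A) (n : Fin t → ℤ) (c : ℤ) (j : Fin t) (g : Γ → M) :
    ∑ a ∈ A, (differenceVector (p j) a - c * ∑ i, n i * differenceVector (p i) a) • g a =
      (g (p j).1 - g (p j).2) - c • ∑ i, n i • (g (p i).1 - g (p i).2) := by
  simp only [sub_smul, Finset.sum_sub_distrib, mul_smul, Finset.sum_smul]
  rw [sum_differenceVector_smul (hp j), ← Finset.smul_sum, Finset.sum_comm]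
  congr 2
  refine Finset.sum_congr rfl fun i _ => ?_
  rw [← Finset.smul_sum, sum_differenceVector_smul (hp i)]

theorem PreservesRelations.exists_smul_iff [AddCommGroup Γ] {φ : Γ → Γ'} (h : PreservesRelations R A φ) {t : ℕ}
    {L : IntLinearForm t} (hL : L.HasCoprimeCoeffs) {k : ℕ} (hk : ∀ i, (L.coeff i).natAbs ≤ k)
    (hR : 1 + k * L.multiplierHeight ≤ R) {p : Fin t → Γ × Γ} (hp : ∀ i, p i ∈ A ×ˢ A) :
    (∃ r : Γ, ∀ i, (p i).1 - (p i).2 = L.coeff i • r) ↔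
      ∃ r : Γ', ∀ i, φ (p i).1 - φ (p i).2 = L.coeff i • r := by
  obtain ⟨n, hn, hheight⟩ := L.exists_multiplier hL
  rw [exists_smul_eq_iff L hn fun i => (p i).1 - (p i).2,
    exists_smul_eq_iff L hn fun i => φ (p i).1 - φ (p i).2]
  refine forall_congr' fun j => ?_
  let c : Γ → ℤ := fun a => differenceVector (p j) a -
    L.coeff j * ∑ i, n i * differenceVector (p i) a
  have hc : ∀ a, |c a| ≤ R := by
    intro a
    -- Each difference has coefficients in `{-1, 0, 1}`, so the sum costs only `∑ |n_i|`, the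
    -- multiplier-height; the bound does not depend on `t`.
    have h1 : |∑ i, n i * differenceVector (p i) a| ≤ L.multiplierHeight := by
      refine (Finset.abs_sum_le_sum_abs _ _).trans ?_
      rw [← hheight]
      push_cast
      refine Finset.sum_le_sum fun i _ => ?_
      rw [abs_mul]
      exact mul_le_of_le_one_right (abs_nonneg _) (abs_differenceVector_le _ _)
    have h2 : |L.coeff j| ≤ k := by
      rw [Int.abs_eq_natAbs]; exact_mod_cast hk j
    calc |c a| ≤ |differenceVector (p j) a| +
          |L.coeff j| * |∑ i, n i * differenceVector (p i) a| := by
            rw [← abs_mul]; exact abs_sub _ _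
      _ ≤ 1 + k * L.multiplierHeight :=
            add_le_add (abs_differenceVector_le _ _)
              (mul_le_mul h2 h1 (abs_nonneg _) (by positivity))
      _ ≤ R := by exact_mod_cast hR
  have key := h c hc
  rw [sum_relation_smul hp n _ j φ] at key
  have h1 := sum_relation_smul hp n (L.coeff j) j (id : Γ → Γ)
  simp only [id] at h1
  rw [h1] at key
  exact key

end Relations

/-! ### Smoothing and its effect on the solution count -/

/-- The Cauchy–Schwarz bound for a sum of products over a set of tuples determined by any one
of their entries. -/
theorem sum_prod_mul_le {Γ : Type*} [DecidableEq Γ] {t : ℕ} (ht : 3 ≤ t) {Z : Finset (Fin t → Γ)}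
    {F : Finset Γ} (hZF : ∀ γ ∈ Z, ∀ i, γ i ∈ F)
    (hinj : ∀ i, Set.InjOn (fun γ : Fin t → Γ => γ i) Z) {x e : Γ → ℝ} {ε α : ℝ} (hε : 0 ≤ ε)
    (hα : 0 ≤ α) (hx : ∀ γ, 0 ≤ x γ) (hxα : ∀ γ, x γ ≤ α) (hsq : ∑ γ ∈ F, x γ ^ 2 ≤ α)
    (he : ∀ γ, x γ * e γ ≤ ε) (i : Fin t) :
    ∑ γ ∈ Z, (∏ j, x (γ j)) * e (γ i) ≤ ε * α ^ (t - 2) := by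
  have hcard : ((Finset.univ : Finset (Fin t)).erase i).card = t - 1 := by simp
  -- Index `i` pairs with `e` to give `ε`, two further indices `a, b` are used for Cauchy–Schwarz,
  -- and the remaining `t - 3` factors are each at most `α`.
  obtain ⟨a, ha⟩ : ((Finset.univ : Finset (Fin t)).erase i).Nonempty := by
    rw [← Finset.card_pos]; omega
  have hcard2 := Finset.card_erase_of_mem ha
  obtain ⟨b, hb⟩ : (((Finset.univ : Finset (Fin t)).erase i).erase a).Nonempty := by
    rw [← Finset.card_pos]; omega
  have hcard3 := Finset.card_erase_of_mem hb
  set T := (((Finset.univ : Finset (Fin t)).erase i).erase a).erase b with hT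
  have hTcard : T.card = t - 3 := by omega
  have hsum : ∀ j, ∑ γ ∈ Z, x (γ j) ^ 2 ≤ α := by
    intro j
    rw [← Finset.sum_image (f := fun y => x y ^ 2) (g := fun γ : Fin t → Γ => γ j) (hinj j)]
    refine le_trans (Finset.sum_le_sum_of_subset_of_nonneg ?_ fun _ _ _ => sq_nonneg _) hsq
    intro y hy
    obtain ⟨γ, hγ, rfl⟩ := Finset.mem_image.mp hy
    exact hZF γ hγ j
  have hpt : ∀ γ ∈ Z, (∏ j, x (γ j)) * e (γ i) ≤
      (ε * α ^ (t - 3) / 2) * (x (γ a) ^ 2 + x (γ b) ^ 2) := by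
    intro γ _
    have hprod : ∏ j, x (γ j) = x (γ i) * (x (γ a) * (x (γ b) * ∏ j ∈ T, x (γ j))) := by
      rw [hT, Finset.mul_prod_erase _ (fun j => x (γ j)) hb,
        Finset.mul_prod_erase _ (fun j => x (γ j)) ha,
        Finset.mul_prod_erase _ (fun j => x (γ j)) (Finset.mem_univ i)]
    have hrest : ∏ j ∈ T, x (γ j) ≤ α ^ (t - 3) := by
      rw [← hTcard]
      exact (Finset.prod_le_prod (fun j _ => hx _) fun j _ => hxα _).trans_eq (by simp)
    have hrest0 : 0 ≤ ∏ j ∈ T, x (γ j) := Finset.prod_nonneg fun j _ => hx _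
    have h0 : 0 ≤ x (γ a) * x (γ b) := mul_nonneg (hx _) (hx _)
    calc (∏ j, x (γ j)) * e (γ i)
        = (x (γ i) * e (γ i)) * ((x (γ a) * x (γ b)) * ∏ j ∈ T, x (γ j)) := by rw [hprod]; ring
      _ ≤ ε * ((x (γ a) * x (γ b)) * ∏ j ∈ T, x (γ j)) :=
          mul_le_mul_of_nonneg_right (he _) (mul_nonneg h0 hrest0)
      _ ≤ ε * (((x (γ a) ^ 2 + x (γ b) ^ 2) / 2) * α ^ (t - 3)) := by
          refine mul_le_mul_of_nonneg_left (mul_le_mul ?_ hrest hrest0 (by positivity)) hε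
          nlinarith [sq_nonneg (x (γ a) - x (γ b))]
      _ = _ := by ring
  calc ∑ γ ∈ Z, (∏ j, x (γ j)) * e (γ i)
      ≤ ∑ γ ∈ Z, (ε * α ^ (t - 3) / 2) * (x (γ a) ^ 2 + x (γ b) ^ 2) := Finset.sum_le_sum hpt
    _ = (ε * α ^ (t - 3) / 2) * (∑ γ ∈ Z, x (γ a) ^ 2 + ∑ γ ∈ Z, x (γ b) ^ 2) := by
        rw [← Finset.mul_sum, Finset.sum_add_distrib]
    _ ≤ (ε * α ^ (t - 3) / 2) * (α + α) :=
        mul_le_mul_of_nonneg_left (add_le_add (hsum a) (hsum b)) (by positivity)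
    _ = ε * α ^ (t - 2) := by
        rw [show t - 2 = (t - 3) + 1 by omega, pow_succ]; ring

namespace CharacterSystem

section Smoothing

variable {Γ G : Type*} [AddCommGroup Γ] [AddCommGroup G] [TopologicalSpace G]
  [IsTopologicalAddGroup G] [CompactSpace G] [MeasurableSpace G] [BorelSpace G]
  (X : CharacterSystem Γ G)

/-- Group pairs by their difference. `F` may be larger than `A - A`, so that two smoothings can be
written over a common frequency set. -/
theorem transfer_self_eq_sum [DecidableEq Γ] {A F : Finset Γ} (hF : ∀ p ∈ A ×ˢ A, p.1 - p.2 ∈ F) {f : G → ℝ}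
    (hf : Measurable f) {C : ℝ} (hC : ∀ x, |f x| ≤ C) (x : G) :
    (X.transfer X A id f x : ℂ) = ∑ γ ∈ F, X.coeff f γ * autocorr A γ * X.char γ x := by
  rw [X.transfer_eq_sum X A id hf hC, ← Finset.sum_fiberwise_of_maps_to hF]
  refine Finset.sum_congr rfl fun γ _ => ?_
  rw [Finset.sum_congr rfl fun p hp => by
    rw [id, id, (Finset.mem_filter.mp hp).2], Finset.sum_const, autocorr]
  push_cast
  rw [nsmul_eq_mul]
  ring

theorem coeff_transfer_self [DecidableEq Γ] (A : Finset Γ) {f : G → ℝ} (hf : Measurable f) {C : ℝ}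
    (hC : ∀ x, |f x| ≤ C) (γ : Γ) :
    X.coeff (X.transfer X A id f) γ = X.coeff f γ * autocorr A γ := by
  -- Adjoining `γ` leaves exactly one surviving term, also when `γ` is not a difference.
  set F := insert γ ((A ×ˢ A).image fun p => p.1 - p.2) with hFdef
  have hF : ∀ p ∈ A ×ˢ A, p.1 - p.2 ∈ F := fun p hp =>
    Finset.mem_insert_of_mem (Finset.mem_image_of_mem (fun p : Γ × Γ => p.1 - p.2) hp)
  unfold coeff
  simp only [X.transfer_self_eq_sum hF hf hC, Finset.sum_mul, mul_assoc, ← X.char_sub_left]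
  rw [integral_finsetSum _ fun p _ => ((X.integrable_char _).const_mul _).const_mul _]
  simp only [integral_const_mul, X.integral_char, sub_eq_zero]
  rw [Finset.sum_eq_single γ (fun b _ hb => by simp [hb])
    (fun h => absurd (Finset.mem_insert_self _ _) h)]
  simp [coeff]

theorem coeff_sub {f g : G → ℝ} (hf : Measurable f) (hg : Measurable g) {C D : ℝ}
    (hC : ∀ x, |f x| ≤ C) (hD : ∀ x, |g x| ≤ D) (γ : Γ) :
    X.coeff (fun x => f x - g x) γ = X.coeff f γ - X.coeff g γ := by
  unfold coeff
  rw [← integral_sub (X.integrable_mul_char hf hC γ) (X.integrable_mul_char hg hD γ)]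
  refine integral_congr_ae (Filter.Eventually.of_forall fun x => ?_)
  simp only
  push_cast
  ring

/-- Bessel together with `f² ≤ f`. Having the mean here, rather than `1`, is what gives the power
`α^(t-2)`. -/
theorem sum_norm_coeff_sq_le {f : G → ℝ} (hf : Measurable f)
    (hf1 : ∀ x, f x ∈ Set.Icc (0 : ℝ) 1) (F : Finset Γ) :
    ∑ γ ∈ F, ‖X.coeff f γ‖ ^ 2 ≤ ∫ x, f x ∂normHaar G := by
  have hC : ∀ x, |f x| ≤ 1 := fun x => abs_le.mpr ⟨by linarith [(hf1 x).1], (hf1 x).2⟩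
  refine (sum_le_hasSum F (fun _ _ => by positivity) (X.parseval f hf hC)).trans ?_
  refine integral_mono
    (integrable_normHaar_of_bounded (C := 1) (by fun_prop) fun x => ?_)
    (integrable_normHaar_of_bounded (C := 1) (by fun_prop) fun x => hC x) fun x => ?_
  · rw [norm_pow]; exact pow_le_one₀ (norm_nonneg _) (hC x)
  · have := hf1 x
    nlinarith [this.1, this.2]

theorem integral_le_one {f : G → ℝ} (hf : Measurable f) (hf1 : ∀ x, f x ∈ Set.Icc (0 : ℝ) 1) :
    ∫ x, f x ∂normHaar G ≤ 1 := by
  refine (integral_mono (integrable_normHaar_of_bounded (C := 1) (by fun_prop) fun x => ?_)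
    (integrable_const (1 : ℝ)) fun x => (hf1 x).2).trans_eq (by simp)
  rw [Real.norm_eq_abs, abs_of_nonneg (hf1 x).1]
  exact (hf1 x).2

/-- The large spectrum is finite, of bounded size. -/
theorem exists_large_spectrum {ε : ℝ} (hε : 0 < ε) {m : ℕ} (hm : 1 / ε ^ 2 ≤ m) {f : G → ℝ}
    (hf : Measurable f) (hf1 : ∀ x, f x ∈ Set.Icc (0 : ℝ) 1) :
    ∃ S : Finset Γ, S.card ≤ m ∧ ∀ γ, ε < ‖X.coeff f γ‖ → γ ∈ S := by
  have hcard : ∀ T : Finset Γ, (∀ γ ∈ T, ε < ‖X.coeff f γ‖) → T.card ≤ m := by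
    intro T hT
    have h1 : (T.card : ℝ) * ε ^ 2 ≤ ∑ γ ∈ T, ‖X.coeff f γ‖ ^ 2 := by
      rw [← nsmul_eq_mul]
      exact Finset.card_nsmul_le_sum _ _ _ fun γ hγ => by
        have := hT γ hγ
        gcongr
    have h2 := (h1.trans (X.sum_norm_coeff_sq_le hf hf1 T)).trans (integral_le_one hf hf1)
    rw [← le_div_iff₀ (by positivity)] at h2
    exact_mod_cast h2.trans hm
  have hfin : {γ : Γ | ε < ‖X.coeff f γ‖}.Finite := by
    by_contra hinf
    obtain ⟨T, hT, hTc⟩ := Set.Infinite.exists_subset_card_eq hinf (m + 1)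
    have := hcard T fun γ hγ => hT hγ
    omega
  exact ⟨hfin.toFinset, hcard _ fun γ hγ => (hfin.mem_toFinset.mp hγ),
    fun γ hγ => hfin.mem_toFinset.mpr hγ⟩

/-- A function is approximated in mean by its smoothings with kernels whose autocorrelations are
close to `1` on a sufficiently large finite set. -/
theorem exists_forall_integral_abs_sub_transfer_le [DecidableEq Γ] {f : G → ℝ}
    (hf : Measurable f) (hf1 : ∀ x, f x ∈ Set.Icc (0 : ℝ) 1) {η : ℝ} (hη : 0 < η) :
    ∃ (S : Finset Γ) (δ : ℝ), 0 < δ ∧ ∀ B : Finset Γ, B.Nonempty →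
      (∀ γ ∈ S, 1 - δ ≤ autocorr B γ) →
        ∫ x, |f x - X.transfer X B id f x| ∂normHaar G ≤ η := by
  have hC : ∀ x, |f x| ≤ 1 := fun x => abs_le.mpr ⟨by linarith [(hf1 x).1], (hf1 x).2⟩
  have hP := X.parseval f hf hC
  change HasSum (fun γ => ‖X.coeff f γ‖ ^ 2) _ at hP
  obtain ⟨S, hS⟩ := (hP.eventually
    (lt_mem_nhds (show ∫ x, f x ^ 2 ∂normHaar G - η ^ 2 / 2 < _ by
      linarith [pow_pos hη 2]))).exists
  refine ⟨S, min 1 (η / 2), by positivity, fun B hB hBS => ?_⟩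
  set δ := min 1 (η / 2) with hδ
  have hδ0 : 0 < δ := by positivity
  have hδη : δ ^ 2 ≤ η ^ 2 / 2 := by
    have : δ ≤ η / 2 := min_le_right _ _
    nlinarith
  set u : G → ℝ := fun x => f x - X.transfer X B id f x with hu
  have hg := (X.continuous_transfer X B id hf hC).measurable
  have hg1 := X.transfer_mem_Icc X hB id hf hf1
  have hgC : ∀ x, |X.transfer X B id f x| ≤ 1 := fun x =>
    abs_le.mpr ⟨by linarith [(hg1 x).1], (hg1 x).2⟩
  have hum : Measurable u := hf.sub hg
  have hu1 : ∀ x, |u x| ≤ 1 := fun x =>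
    abs_le.mpr ⟨by linarith [(hf1 x).1, (hg1 x).2], by linarith [(hf1 x).2, (hg1 x).1]⟩
  have hPu := X.parseval u hum hu1
  change HasSum (fun γ => ‖X.coeff u γ‖ ^ 2) _ at hPu
  have hcoeff : ∀ γ, ‖X.coeff u γ‖ ^ 2 = ‖X.coeff f γ‖ ^ 2 * (1 - autocorr B γ) ^ 2 := by
    intro γ
    rw [hu, X.coeff_sub hf hg hC hgC, X.coeff_transfer_self B hf hC,
      show X.coeff f γ - X.coeff f γ * autocorr B γ =
        X.coeff f γ * ((1 - autocorr B γ : ℝ) : ℂ) by push_cast; ring,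
      norm_mul, mul_pow, Complex.norm_real, Real.norm_eq_abs, sq_abs]
  have hfinsum : HasSum (fun γ => if γ ∈ S then (1 - δ ^ 2) * ‖X.coeff f γ‖ ^ 2 else 0)
      (∑ γ ∈ S, (1 - δ ^ 2) * ‖X.coeff f γ‖ ^ 2) := by
    rw [← Finset.sum_congr rfl fun γ hγ =>
      if_pos (α := ℝ) (t := (1 - δ ^ 2) * ‖X.coeff f γ‖ ^ 2) (e := 0) hγ]
    exact hasSum_sum_of_ne_finset_zero fun γ hγ => if_neg hγ
  -- Smoothing leaves a fraction at most `δ²` of the energy on `S` and at most all of it elsewhere,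
  -- where less than `η² / 2` remains.
  have hle : ∫ x, u x ^ 2 ∂normHaar G ≤
      ∫ x, f x ^ 2 ∂normHaar G - ∑ γ ∈ S, (1 - δ ^ 2) * ‖X.coeff f γ‖ ^ 2 := by
    refine hasSum_le (fun γ => ?_) hPu (hP.sub hfinsum)
    simp only [hcoeff]
    have h0 := autocorr_nonneg B γ
    have h1 := autocorr_le_one B γ
    have hsq : 0 ≤ ‖X.coeff f γ‖ ^ 2 := by positivity
    split_ifs with hγ
    · have h2 := hBS γ hγ
      have h3 : (1 - autocorr B γ) ^ 2 ≤ δ ^ 2 := pow_le_pow_left₀ (by linarith) (by linarith) 2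
      nlinarith
    · have h3 : (1 - autocorr B γ) ^ 2 ≤ 1 := pow_le_one₀ (by linarith) (by linarith)
      nlinarith
  have hsq : ∫ x, u x ^ 2 ∂normHaar G ≤ η ^ 2 := by
    rw [← Finset.mul_sum] at hle
    have h1 := (X.sum_norm_coeff_sq_le hf hf1 S).trans (integral_le_one hf hf1)
    have h2 : δ ^ 2 * ∑ γ ∈ S, ‖X.coeff f γ‖ ^ 2 ≤ δ ^ 2 := mul_le_of_le_one_right (by positivity) h1
    linarith
  have hint : Integrable (fun x => u x ^ 2) (normHaar G) :=
    integrable_normHaar_of_bounded (C := 1) (by fun_prop) fun x => by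
      rw [norm_pow]; exact pow_le_one₀ (norm_nonneg _) (hu1 x)
  -- AM–GM, `|u| ≤ u² / (2η) + η / 2`, passes from mean square to mean.
  calc ∫ x, |u x| ∂normHaar G ≤ ∫ x, (u x ^ 2 / (2 * η) + η / 2) ∂normHaar G := by
        refine integral_mono
          (integrable_normHaar_of_bounded (C := 1) (by fun_prop) fun x => by simpa using hu1 x)
          ((hint.div_const _).add (integrable_const _)) fun x => ?_
        simp only
        rw [div_add_div _ _ (by positivity) two_ne_zero, le_div_iff₀ (by positivity)]
        nlinarith [sq_nonneg (|u x| - η), sq_abs (u x)]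
    _ = (∫ x, u x ^ 2 ∂normHaar G) / (2 * η) + η / 2 := by
        rw [integral_add (hint.div_const _) (integrable_const _), integral_div]
        simp
    _ ≤ η ^ 2 / (2 * η) + η / 2 := by gcongr
    _ = η := by field_simp; ring

end Smoothing

end CharacterSystem

namespace CharacterSystem

section Comparison

variable {Γ G : Type*} [AddCommGroup Γ] [AddCommGroup G] [TopologicalSpace G]
  [IsTopologicalAddGroup G] [CompactSpace G] [T2Space G] [SecondCountableTopology G]
  [MeasurableSpace G] [BorelSpace G] (X : CharacterSystem Γ G)

/-- Both sides expand over the same tuples of pairs from `A` with the same weights, and `φ`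
preserves which tuples are resonant. -/
theorem sol_transfer_eq {Γ' H : Type*} [AddCommGroup Γ'] [AddCommGroup H] [TopologicalSpace H]
    [IsTopologicalAddGroup H] [CompactSpace H] [T2Space H] [SecondCountableTopology H]
    [MeasurableSpace H] [BorelSpace H] (Y : CharacterSystem Γ' H) {R : ℕ} {A : Finset Γ}
    {φ : Γ → Γ'} (hφ : PreservesRelations R A φ) {t : ℕ}
    {L : IntLinearForm t} (hL : L.HasCoprimeCoeffs) {k : ℕ} (hk : ∀ i, (L.coeff i).natAbs ≤ k)
    (hR : 1 + k * L.multiplierHeight ≤ R) {f : G → ℝ} (hf : Measurable f) {C : ℝ}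
    (hC : ∀ x, |f x| ≤ C) :
    L.sol (fun _ => X.transfer Y A φ f) = L.sol (fun _ => X.transfer X A id f) := by
  classical
  rw [← Complex.ofReal_inj, L.sol_ofReal, L.sol_ofReal]
  simp only [X.transfer_eq_sum _ _ _ hf hC]
  rw [Y.sol_sum_char L hL (A ×ˢ A) (fun p => X.coeff f (p.1 - p.2) / A.card)
    fun p => φ p.1 - φ p.2, X.sol_sum_char L hL (A ×ˢ A)
    (fun p => X.coeff f (p.1 - p.2) / A.card) fun p => id p.1 - id p.2]
  refine Finset.sum_congr rfl fun p hp => ?_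
  have h := hφ.exists_smul_iff hL hk hR (Fintype.mem_piFinset.mp hp)
  simp only [id, h]

theorem sol_transfer_self_eq_sum [DecidableEq Γ] {A F : Finset Γ}
    (hF : ∀ p ∈ A ×ˢ A, p.1 - p.2 ∈ F) {t : ℕ} {L : IntLinearForm t} (hL : L.HasCoprimeCoeffs)
    {f : G → ℝ} (hf : Measurable f) {C : ℝ} (hC : ∀ x, |f x| ≤ C)
    [DecidablePred fun γ : Fin t → Γ => ∃ r : Γ, ∀ i, γ i = L.coeff i • r] :
    ((L.sol fun _ => X.transfer X A id f : ℝ) : ℂ) =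
      ∑ γ ∈ (Fintype.piFinset fun _ : Fin t => F).filter
          fun γ : Fin t → Γ => ∃ r : Γ, ∀ i, γ i = L.coeff i • r,
        (∏ i, X.coeff f (γ i)) * ((∏ i, autocorr A (γ i) : ℝ) : ℂ) := by
  rw [L.sol_ofReal]
  simp only [X.transfer_self_eq_sum hF hf hC]
  have h := X.sol_sum_char L hL F (fun γ => X.coeff f γ * autocorr A γ) fun γ => γ
  rw [h, Finset.sum_filter]
  refine Finset.sum_congr rfl fun γ _ => ?_
  rw [Finset.prod_mul_distrib]
  push_cast
  congr

/-- Two smoothings which almost preserve the large Fourier coefficients have almost the same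
number of solutions. -/
theorem abs_sol_transfer_sub_sol_transfer_le [DecidableEq Γ] {ε : ℝ} (hε : 0 < ε) {f : G → ℝ}
    (hf : Measurable f) (hf1 : ∀ x, f x ∈ Set.Icc (0 : ℝ) 1) {A B : Finset Γ}
    (hA : ∀ γ, ε < ‖X.coeff f γ‖ → 1 - ε ≤ autocorr A γ)
    (hB : ∀ γ, ε < ‖X.coeff f γ‖ → 1 - ε ≤ autocorr B γ) {t : ℕ} (ht : 3 ≤ t)
    {L : IntLinearForm t} (hL : L.HasCoprimeCoeffs) (hG : L.IsAdmissible G) :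
    |L.sol (fun _ => X.transfer X A id f) - L.sol (fun _ => X.transfer X B id f)| ≤
      t * ε * (∫ x, f x ∂normHaar G) ^ (t - 2) := by
  classical
  have hC : ∀ x, |f x| ≤ 1 := fun x => abs_le.mpr ⟨by linarith [(hf1 x).1], (hf1 x).2⟩
  set α := ∫ x, f x ∂normHaar G with hα
  have hα0 : 0 ≤ α := integral_nonneg fun x => (hf1 x).1
  have hα1 : α ≤ 1 := integral_le_one hf hf1
  set F := (A ×ˢ A).image (fun p => p.1 - p.2) ∪ (B ×ˢ B).image (fun p => p.1 - p.2) with hF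
  have hFA : ∀ p ∈ A ×ˢ A, p.1 - p.2 ∈ F := fun p hp =>
    Finset.mem_union_left _ (Finset.mem_image_of_mem (fun p : Γ × Γ => p.1 - p.2) hp)
  have hFB : ∀ p ∈ B ×ˢ B, p.1 - p.2 ∈ F := fun p hp =>
    Finset.mem_union_right _ (Finset.mem_image_of_mem (fun p : Γ × Γ => p.1 - p.2) hp)
  set Z := (Fintype.piFinset fun _ : Fin t => F).filter
    fun γ => ∃ r : Γ, ∀ i, γ i = L.coeff i • r with hZ
  have hZF : ∀ γ ∈ Z, ∀ i, γ i ∈ F := fun γ hγ =>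
    Fintype.mem_piFinset.mp (Finset.mem_filter.mp hγ).1
  -- Dilation by `c_i` is injective on the dual, so any one entry of `(c_j r)` determines `r`.
  have hinj : ∀ i, Set.InjOn (fun γ : Fin t → Γ => γ i) Z := by
    intro i γ hγ γ' hγ' (heq : γ i = γ' i)
    obtain ⟨r, hr⟩ := (Finset.mem_filter.mp (Finset.mem_coe.mp hγ)).2
    obtain ⟨r', hr'⟩ := (Finset.mem_filter.mp (Finset.mem_coe.mp hγ')).2
    rw [hr, hr'] at heq
    have : r = r' := X.smul_injective_of_surjective (hG i) heq
    funext j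
    rw [hr, hr', this]
  -- Either the coefficient is large and both autocorrelations lie in `[1 - ε, 1]`, or the
  -- coefficient itself is at most `ε`.
  have he : ∀ γ, ‖X.coeff f γ‖ * |autocorr A γ - autocorr B γ| ≤ ε := by
    intro γ
    have h1 := autocorr_nonneg A γ
    have h2 := autocorr_nonneg B γ
    have h3 := autocorr_le_one A γ
    have h4 := autocorr_le_one B γ
    have h5 : ‖X.coeff f γ‖ ≤ 1 := (X.norm_coeff_le (fun x => (hf1 x).1) γ).trans hα1
    rcases lt_or_ge ε ‖X.coeff f γ‖ with h | h
    · have : |autocorr A γ - autocorr B γ| ≤ ε :=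
        abs_le.mpr ⟨by linarith [hA γ h], by linarith [hB γ h]⟩
      exact (mul_le_of_le_one_left (abs_nonneg _) h5).trans this
    · have : |autocorr A γ - autocorr B γ| ≤ 1 := abs_le.mpr ⟨by linarith, by linarith⟩
      exact (mul_le_of_le_one_right (norm_nonneg _) this).trans h
  have hmain : ∀ i, ∑ γ ∈ Z, (∏ j, ‖X.coeff f (γ j)‖) * |autocorr A (γ i) - autocorr B (γ i)| ≤
      ε * α ^ (t - 2) := fun i =>
    sum_prod_mul_le ht hZF hinj (x := fun γ => ‖X.coeff f γ‖)
      (e := fun γ => |autocorr A γ - autocorr B γ|) hε.le hα0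
      (fun _ => norm_nonneg _) (X.norm_coeff_le fun x => (hf1 x).1)
      (X.sum_norm_coeff_sq_le hf hf1 F) he i
  have habs : ∀ (A : Finset Γ) (γ : Γ), |autocorr A γ| ≤ 1 := fun A γ => by
    rw [abs_of_nonneg (autocorr_nonneg A γ)]; exact autocorr_le_one A γ
  rw [← Real.norm_eq_abs, ← Complex.norm_real, Complex.ofReal_sub,
    X.sol_transfer_self_eq_sum hFA hL hf hC, X.sol_transfer_self_eq_sum hFB hL hf hC,
    ← Finset.sum_sub_distrib]
  calc _ ≤ ∑ γ ∈ Z, (∏ j, ‖X.coeff f (γ j)‖) * ∑ i, |autocorr A (γ i) - autocorr B (γ i)| := by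
        refine (norm_sum_le _ _).trans (Finset.sum_le_sum fun γ _ => ?_)
        rw [← mul_sub, ← Complex.ofReal_sub, norm_mul, norm_prod, Complex.norm_real,
          Real.norm_eq_abs]
        exact mul_le_mul_of_nonneg_left
          (abs_prod_sub_prod_le _ (fun i _ => habs _ _) fun i _ => habs _ _) (by positivity)
    _ = ∑ i, ∑ γ ∈ Z, (∏ j, ‖X.coeff f (γ j)‖) * |autocorr A (γ i) - autocorr B (γ i)| := by
        simp only [Finset.mul_sum]
        exact Finset.sum_comm
    _ ≤ ∑ _i : Fin t, ε * α ^ (t - 2) := Finset.sum_le_sum fun i _ => hmain i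
    _ = t * ε * α ^ (t - 2) := by simp [mul_assoc]

end Comparison

/-- Smoothing with a kernel that almost preserves the large Fourier coefficients changes the
number of solutions little. -/
theorem abs_sol_sub_sol_transfer_le {Γ G : Type} [AddCommGroup Γ] [DecidableEq Γ]
    [AddCommGroup G] [TopologicalSpace G]
    [IsTopologicalAddGroup G] [CompactSpace G] [T2Space G] [SecondCountableTopology G]
    [MeasurableSpace G] [BorelSpace G] (X : CharacterSystem Γ G) {ε : ℝ} (hε : 0 < ε) {f : G → ℝ}
    (hf : Measurable f) (hf1 : ∀ x, f x ∈ Set.Icc (0 : ℝ) 1) {A : Finset Γ}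
    (hA : ∀ γ, ε < ‖X.coeff f γ‖ → 1 - ε ≤ autocorr A γ) {t : ℕ} (ht : 3 ≤ t)
    {L : IntLinearForm t} (hL : L.HasCoprimeCoeffs) (hG : L.IsAdmissible G) :
    |L.sol (fun _ => f) - L.sol (fun _ => X.transfer X A id f)| ≤
      t * ε * (∫ x, f x ∂normHaar G) ^ (t - 2) := by
  have hC : ∀ x, |f x| ≤ 1 := fun x => abs_le.mpr ⟨by linarith [(hf1 x).1], (hf1 x).2⟩
  -- To avoid infinite Fourier sums, `f` is compared with a second smoothing by `B`, close to `f` in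
  -- mean and also nearly fixing the large spectrum. The size of `B` is irrelevant, since only its
  -- error `η` enters and `η` is arbitrary.
  refine le_of_forall_pos_le_add fun η hη => ?_
  have ht0 : (0 : ℝ) < t := by exact_mod_cast (by omega : 0 < t)
  obtain ⟨S, δ, hδ, hS⟩ := X.exists_forall_integral_abs_sub_transfer_le hf hf1
    (show 0 < η / t by positivity)
  obtain ⟨m, hm⟩ := exists_nat_ge (1 / ε ^ 2)
  obtain ⟨T, -, hT⟩ := X.exists_large_spectrum hε hm hf hf1
  obtain ⟨N, hN⟩ := exists_autocorr_ge (S ∪ T).card (show 0 < min δ ε by positivity)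
  obtain ⟨B, hB, -, hBST⟩ := hN Γ (S ∪ T) le_rfl
  have h1 := hS B hB fun γ hγ => by
    have := hBST γ (Finset.mem_union_left _ hγ)
    linarith [min_le_left δ ε]
  have h2 : ∀ γ, ε < ‖X.coeff f γ‖ → 1 - ε ≤ autocorr B γ := fun γ hγ => by
    have := hBST γ (Finset.mem_union_right _ (hT γ hγ))
    linarith [min_le_right δ ε]
  have hg1 := X.transfer_mem_Icc X hB id hf hf1
  have h3 := L.abs_sol_sub_sol_le (by omega) hG hf
    (X.continuous_transfer X B id hf hC).measurable hC
    fun x => abs_le.mpr ⟨by linarith [(hg1 x).1], (hg1 x).2⟩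
  have h4 := X.abs_sol_transfer_sub_sol_transfer_le hε hf hf1 h2 hA ht hL hG
  have h5 : (t : ℝ) * ∫ x, |f x - X.transfer X B id f x| ∂normHaar G ≤ η := by
    rw [le_div_iff₀ ht0] at h1
    linarith
  have := abs_sub_le (L.sol fun _ => f) (L.sol fun _ => X.transfer X B id f)
    (L.sol fun _ => X.transfer X A id f)
  linarith

/-- Rectifiability of the character groups yields a transfer of functions. -/
theorem exists_forall_transfers {ε : ℝ} (hε : 0 < ε) (h k : ℕ) : ∃ N : ℕ,
    ∀ {Γ G Γ' H : Type} [AddCommGroup Γ] [AddCommGroup G] [TopologicalSpace G]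
      [IsTopologicalAddGroup G] [CompactSpace G] [T2Space G] [SecondCountableTopology G]
      [MeasurableSpace G] [BorelSpace G] [AddCommGroup Γ'] [AddCommGroup H] [TopologicalSpace H]
      [IsTopologicalAddGroup H] [CompactSpace H] [T2Space H] [SecondCountableTopology H]
      [MeasurableSpace H] [BorelSpace H],
      CharacterSystem Γ G → CharacterSystem Γ' H →
      (∀ n ≤ N, FreimanTransfers n (1 + k * h) Γ Γ') → Transfers ε h k G H := by
  classical
  -- The bounds `m` and `N` are fixed before `f`, in terms of `ε` alone.
  obtain ⟨m, hm⟩ := exists_nat_ge (1 / ε ^ 2)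
  obtain ⟨N, hN⟩ := exists_autocorr_ge m hε
  refine ⟨N, ?_⟩
  intro Γ G Γ' H _ _ _ _ _ _ _ _ _ _ _ _ _ _ _ _ _ _ X Y hF f α hf hf1 hα
  have hC : ∀ x, |f x| ≤ 1 := fun x => abs_le.mpr ⟨by linarith [(hf1 x).1], (hf1 x).2⟩
  obtain ⟨S, hSm, hS⟩ := X.exists_large_spectrum hε hm hf hf1
  obtain ⟨A, hA, hAN, hAS⟩ := hN Γ S hSm
  obtain ⟨φ, hφ⟩ := (hF A.card hAN).exists_preservesRelations
  refine ⟨X.transfer Y A φ f, X.continuous_transfer Y A φ hf hC,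
    X.transfer_mem_Icc Y hA φ hf hf1, ?_, ?_⟩
  · rw [X.integral_transfer Y hA (hφ.injOn (Nat.le_add_right _ _)) hf hC, hα]
  · intro t L ht hL hG _ hk hh
    have hR : 1 + k * L.multiplierHeight ≤ 1 + k * h := by gcongr
    rw [X.sol_transfer_eq Y hφ hL hk.2 hR hf hC, ← hα]
    exact X.abs_sol_sub_sol_transfer_le hε hf hf1 (fun γ hγ => hAS γ (hS γ hγ)) ht hL hG

end CharacterSystem

/-! ### The circle, the groups `ZMod p`, and the conclusion -/

/-- The monomials `fourier n` on the circle. -/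
noncomputable def circleCharacterSystem : CharacterSystem ℤ UnitAddCircle where
  char n x := fourier n x
  continuous_char n := (fourier n).continuous
  norm_char n x := by rw [fourier_apply]; exact Circle.norm_coe _
  char_add_left _ _ _ := fourier_add
  char_add_right n x y := by
    simp only [fourier_apply, smul_add, AddCircle.toCircle_add, Circle.coe_mul]
  eq_zero_of_char_eq_one n hn := by
    by_contra h0
    -- A shift by half a period changes the sign, so a constant value `1` is impossible for `n ≠ 0`.
    have h1 := fourier_add_half_inv_index h0 (one_pos (α := ℝ)) 0
    rw [hn, hn] at h1
    norm_num at h1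
  parseval f hf hf1 := by
    have hmem : MemLp (fun x => (f x : ℂ)) 2 (AddCircle.haarAddCircle (T := 1)) :=
      MemLp.of_bound (by fun_prop) 1 (Filter.Eventually.of_forall fun x => by
        rw [Complex.norm_real]; exact hf1 x)
    have h := hasSum_sq_fourierCoeff hmem.toLp
    have hae := hmem.coeFn_toLp
    convert h using 1
    · ext n
      rw [fourierCoeff_congr_ae hae, fourierCoeff]
      simp only [fourier_neg, smul_eq_mul, mul_comm]
      rfl
    · refine integral_congr_ae ?_
      filter_upwards [hae] with x hx
      rw [hx, Complex.norm_real, Real.norm_eq_abs, sq_abs]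

section ZMod

variable (p : ℕ) [Fact p.Prime]

theorem integral_normHaar_zmod (g : ZMod p → ℂ) :
    ∫ x, g x ∂normHaar (ZMod p) = (p : ℂ)⁻¹ * ∑ x, g x := by
  have h0 : ∀ x, (normHaar (ZMod p)).real {x} = (normHaar (ZMod p)).real {0} := fun x => by
    have := measure_preimage_add (normHaar (ZMod p)) x {x}
    rw [Measure.real, Measure.real, ← this]
    congr 2
    ext y
    simp
  have h1 : ∑ x : ZMod p, (normHaar (ZMod p)).real {x} = 1 := by
    rw [sum_measureReal_singleton]
    simp
  have hp : (p : ℝ) ≠ 0 := by exact_mod_cast (Fact.out : p.Prime).ne_zero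
  have h2 : (normHaar (ZMod p)).real {0} = (p : ℝ)⁻¹ := by
    simp only [h0, Finset.sum_const, Finset.card_univ, ZMod.card, nsmul_eq_mul] at h1
    exact eq_inv_of_mul_eq_one_right h1
  rw [integral_fintype Integrable.of_finite]
  simp only [h0, h2, Finset.mul_sum, Complex.real_smul]
  push_cast
  rfl

theorem parseval_zmod (f : ZMod p → ℝ) :
    ∑ γ, ‖∫ x, (f x : ℂ) * conj (ZMod.stdAddChar (γ * x)) ∂normHaar (ZMod p)‖ ^ 2 =
      ∫ x, f x ^ 2 ∂normHaar (ZMod p) := by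
  have hp : (p : ℂ) ≠ 0 := by exact_mod_cast (Fact.out : p.Prime).ne_zero
  have horth : ∀ x y : ZMod p,
      ∑ γ : ZMod p, conj (ZMod.stdAddChar (γ * x)) * ZMod.stdAddChar (γ * y) =
        if x = y then (p : ℂ) else 0 := by
    intro x y
    have h := AddChar.sum_mulShift (y - x) (ZMod.isPrimitive_stdAddChar p)
    simp only [sub_eq_zero, ZMod.card, eq_comm (a := y), Nat.cast_ite, Nat.cast_zero] at h
    rw [← h]
    refine Finset.sum_congr rfl fun γ _ => ?_
    rw [mul_sub, sub_eq_neg_add, AddChar.map_add_eq_mul, AddChar.map_neg_eq_conj]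
  rw [← Complex.ofReal_inj, ← integral_complex_ofReal, integral_normHaar_zmod]
  simp only [integral_normHaar_zmod]
  push_cast
  simp only [← Complex.mul_conj', map_mul, map_inv₀, map_natCast, map_sum, Complex.conj_conj,
    Complex.conj_ofReal]
  calc _ = ∑ γ : ZMod p, ∑ x : ZMod p, ∑ y : ZMod p, (p : ℂ)⁻¹ ^ 2 * (f x * f y) *
        (conj (ZMod.stdAddChar (γ * x)) * ZMod.stdAddChar (γ * y)) := by
        refine Finset.sum_congr rfl fun γ _ => ?_
        rw [mul_mul_mul_comm, Finset.sum_mul_sum, Finset.mul_sum]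
        refine Finset.sum_congr rfl fun x _ => ?_
        rw [Finset.mul_sum]
        exact Finset.sum_congr rfl fun y _ => by ring
    _ = ∑ x : ZMod p, ∑ y : ZMod p, (p : ℂ)⁻¹ ^ 2 * (f x * f y) * if x = y then (p : ℂ) else 0 := by
        rw [Finset.sum_comm]
        refine Finset.sum_congr rfl fun x _ => ?_
        rw [Finset.sum_comm]
        refine Finset.sum_congr rfl fun y _ => ?_
        rw [← Finset.mul_sum, horth]
    _ = _ := by
        rw [Finset.mul_sum]
        refine Finset.sum_congr rfl fun x _ => ?_
        simp only [mul_ite, mul_zero, Finset.sum_ite_eq, Finset.mem_univ, if_true]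
        field_simp

/-- The additive characters of `ℤ/pℤ`. -/
noncomputable def zmodCharacterSystem : CharacterSystem (ZMod p) (ZMod p) where
  char γ x := ZMod.stdAddChar (γ * x)
  continuous_char _ := continuous_of_discreteTopology
  norm_char γ x := by rw [ZMod.stdAddChar_apply]; exact Circle.norm_coe _
  char_add_left γ γ' x := by rw [add_mul, AddChar.map_add_eq_mul]
  char_add_right γ x y := by rw [mul_add, AddChar.map_add_eq_mul]
  eq_zero_of_char_eq_one γ hγ := by
    have h := hγ 1
    rw [mul_one, ← (ZMod.stdAddChar (N := p)).map_zero_eq_one] at h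
    exact ZMod.injective_stdAddChar h
  parseval f _ _ := parseval_zmod p f ▸ hasSum_fintype _

end ZMod

theorem mainTheorem4 (ε : ℝ) (hε : 0 < ε) (h : ℕ) (hh : 0 < h) (k : ℕ) :
    ∃ C : ℕ,
      Transfers ε h k UnitAddCircle UnitAddCircle ∧
      (∀ (p : ℕ) [Fact p.Prime], C ≤ p →
        Transfers ε h k (ZMod p) UnitAddCircle ∧ Transfers ε h k UnitAddCircle (ZMod p)) ∧
      (∀ (p q : ℕ) [Fact p.Prime] [Fact q.Prime], C ≤ p → C ≤ q →
        Transfers ε h k (ZMod p) (ZMod q)) := by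
  obtain ⟨N, hN⟩ := CharacterSystem.exists_forall_transfers hε h k
  obtain ⟨C, hC⟩ := exists_freimanTransfers_threshold N (1 + k * h)
  refine ⟨C, ?_, fun p _ hp => ⟨?_, ?_⟩, fun p q _ _ hp hq => ?_⟩
  -- Frequencies need no renaming here, but smoothing still supplies continuity.
  · exact hN circleCharacterSystem circleCharacterSystem fun n _ => .refl _ _ _
  · exact hN (zmodCharacterSystem p) circleCharacterSystem fun n hn => (hC n hn).1 p hp
  · exact hN circleCharacterSystem (zmodCharacterSystem p) fun n hn => (hC n hn).2 p hp
  -- Residues modulo `p` are rectified to integers and then reduced modulo `q`.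
  · exact hN (zmodCharacterSystem p) (zmodCharacterSystem q) fun n hn =>
      ((hC n hn).1 p hp).trans ((hC n hn).2 q hq)
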